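/- **Setting.** Fix $x^*>0$, pressures $p_I>p_0$, viscosity $\mu>0$, porosity $\phi>0$, and let $X=C[0,x^*]$ with the supremum norm and its Borel $\sigma$-algebra. For $u\in X$ consider the one-dimensional moving boundary problem for the pressure $p(x,t)$ and the front $\Upsilon(t)$, $$\frac{d}{dx}\Big[\tfrac1\mu e^{u(x)}\frac{d}{dx}p(x,t)\Big]=0\quad (0<x<\Upsilon(t),\ t>0),\qquad p(x,0)=p_0\ (0<x\le x^*),\qquad p(0,t)=p_I\ (t\ge 0),$$ $$\frac{d}{dt}\Upsilon(t)+\frac{1}{\phi\mu}e^{u(\Upsilon(t))}\frac{d}{dx}p(\Upsilon(t),t)=0\ (t>0),\qquad \Upsilon(0)=0,\qquad p(x,t)=p_0\ (\Upsilon(t)\le x\le x^*,\ t>0),$$ up to the filling time $\tau^*$, at which $\Upsilon(\tau^*)=x^*$. Let $t_1<\dots<t_N$ be positive observation times and $x_1,\dots,x_M\in[0,x^*]$ sensor locations. The forward maps $\mathcal G_s:X\to\mathbb R^{M+1}$ are $$\mathcal G_s(u)=\big(\Upsilon(t_s\wedge\tau^*),\ p(x_1,t_s\wedge\tau^*),\dots,p(x_M,t_s\wedge\tau^*)\big),\qquad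 s=1,\dots,N.$$ Let $\bar u\in X$, $\sigma_0,\nu,l>0$, and let $$c(x,y)=\sigma_0^2\,\frac{2^{1-\nu}}{\Gamma(\nu)}\Big(\frac{|x-y|}{l}\Big)^{\nu}K_\nu\Big(\frac{|x-y|}{l}\Big)\quad(x\ne y),\qquad c(x,x)=\sigma_0^2,$$ be the Whittle–Matérn covariance function ($K_\nu$ is the modified Bessel function of the second kind). Let $\mu_0=N(\bar u,\mathcal C)$ be the Gaussian measure on $X$ with mean $\bar u$ and covariance function $c$. Let $u\sim\mu_0$ and $y_s=\mathcal G_s(u)+\eta_s$, where $\eta_s\sim N(0,\Gamma_s)$, $\Gamma_s=\mathrm{diag}(\Gamma_s^{\Upsilon},\Gamma_s^{p})$ with $\Gamma_s^{\Upsilon}>0$ and $\Gamma_s^{p}\in\mathbb R^{M\times M}$ symmetric positive definite, and $u,\eta_1,\dots,\eta_N$ are independent. For arbitrary constants $a_s>0$ let $$l_s(u,y_s)=a_s\exp\Big[-\tfrac12\big\|\Gamma_s^{-1/2}(y_s-\mathcal G_s(u))\big\|^2\Big].$$ **Theorem.** The forward maps $\mathcal G_1,\dots,\mathcal G_N$ are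 well defined by the moving boundary problem, and the Gaussian measure $\mu_0$ on $X=C[0,x^*]$ exists and is unique. For each $n\in\{1,\dots,N\}$ the (regular) conditional distribution $\mu_n=\mu_n(\cdot\mid y_1,\dots,y_n)$ of $u$ given $y_1,\dots,y_n$ exists; it is unique up to a null set of data $(y_1,\dots,y_n)$ with respect to their law, and it has a version such that for all $(y_1,\dots,y_n)\in(\mathbb R^{M+1})^n$ the product of likelihoods is $\mu_0$-integrable in $u$, $$Z_n=\int_X\prod_{s=1}^n l_s(u,y_s)\,\mu_0(du)>0,\qquad \mu_n\ll\mu_0,\qquad \frac{d\mu_n}{d\mu_0}(u)=\frac1{Z_n}\prod_{s=1}^n l_s(u,y_s)\quad\text{for }\mu_0\text{-a.e. }u.$$ -/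

import Mathlib

open MeasureTheory ProbabilityTheory Matrix Set
open scoped ENNReal

noncomputable section

/-- The space `X = C[0, L]` of continuous log-permeabilities, with the supremum norm. -/
abbrev LogPerm (L : ℝ) : Type := C(Icc (0 : ℝ) L, ℝ)

/-- `C[0, L]` carries its Borel sigma-algebra. -/
instance LogPerm.measurableSpace (L : ℝ) : MeasurableSpace C(Icc (0 : ℝ) L, ℝ) := borel _

instance LogPerm.borelSpace (L : ℝ) : BorelSpace C(Icc (0 : ℝ) L, ℝ) := ⟨rfl⟩

/-! ### The one-dimensional moving boundary problem -/

/-- The known physical constants: length `xstar` of the medium, injection pressure `pI`, initial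
(and front) pressure `p0`, viscosity `visc` and porosity `poros`. Resin is injected, so `p0 < pI`. -/
structure RTMParams where
  xstar : ℝ
  pI : ℝ
  p0 : ℝ
  visc : ℝ
  poros : ℝ
  xstar_pos : 0 < xstar
  p0_lt_pI : p0 < pI
  visc_pos : 0 < visc
  poros_pos : 0 < poros

/-- The permeability `exp u`, with `u` extended by constants outside `[0, xstar]` (only its values
on `(0, xstar]` matter below). -/
def RTMParams.perm (P : RTMParams) (u : LogPerm P.xstar) (x : ℝ) : ℝ :=
  Real.exp (IccExtend P.xstar_pos.le u x)

/-- `Υ` (front location), `p` (pressure, `p x t`) and `dp` (its space derivative in the resin) solve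
the one-dimensional moving boundary problem with log-permeability `u` up to the filling time `τ`, at
which the front reaches `xstar`. The pressure is continuous in space up to the boundary of the resin
domain `(0, Υ t)`, and its derivative at the front is the one from inside the resin. -/
structure IsRTMSolution (P : RTMParams) (u : LogPerm P.xstar)
    (τ : ℝ) (Υ : ℝ → ℝ) (p dp : ℝ → ℝ → ℝ) : Prop where
  filling_pos : 0 < τ
  front_filling : Υ τ = P.xstar
  front_zero : Υ 0 = 0
  front_continuous : ContinuousOn Υ (Icc 0 τ)
  front_pos : ∀ t ∈ Ioc 0 τ, 0 < Υ t
  front_lt : ∀ t ∈ Ico 0 τ, Υ t < P.xstar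
  /-- `d/dx [ (1/visc) e^u dp/dx ] = 0` in the resin. -/
  pressure_deriv : ∀ t ∈ Ioc 0 τ, ∀ x ∈ Ioo 0 (Υ t), HasDerivAt (fun ξ => p ξ t) (dp x t) x
  darcy : ∀ t ∈ Ioc 0 τ, ∀ x ∈ Ioo 0 (Υ t),
    HasDerivAt (fun ξ => 1 / P.visc * P.perm u ξ * dp ξ t) 0 x
  pressure_continuous : ∀ t ∈ Ioc 0 τ, ContinuousOn (fun ξ => p ξ t) (Icc 0 (Υ t))
  pressure_deriv_front : ∀ t ∈ Ioc 0 τ,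
    HasDerivWithinAt (fun ξ => p ξ t) (dp (Υ t) t) (Iic (Υ t)) (Υ t)
  /-- `dΥ/dt + (1/(poros visc)) e^{u(Υ)} dp/dx(Υ, t) = 0`. -/
  front_velocity : ∀ t ∈ Ioo 0 τ,
    HasDerivAt Υ (-(1 / (P.poros * P.visc) * P.perm u (Υ t) * dp (Υ t) t)) t
  pressure_initial : ∀ x ∈ Ioc 0 P.xstar, p x 0 = P.p0
  pressure_inlet : ∀ t ∈ Icc 0 τ, p 0 t = P.pI
  /-- At the front, and in the region that the resin has not reached, the pressure is `p0`. -/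
  pressure_outside : ∀ t ∈ Ioc 0 τ, ∀ x ∈ Icc (Υ t) P.xstar, p x t = P.p0

/-- The space `ℝ^{M+1}` of data at one observation time: the coordinate `Sum.inl ()` is the front
location, the coordinate `Sum.inr m` is the pressure at the `m`-th sensor. -/
abbrev DataSpace (M : ℕ) : Type := EuclideanSpace ℝ (Unit ⊕ Fin M)

/-- `G` is the forward map at the observation time `t` with sensors at `x m`:
`G u = (Υ (t ∧ τ), (p (x m) (t ∧ τ))_m)`, where `Υ, p` solve the moving boundary problem with
log-permeability `u` and `τ` is the filling time. -/
def IsForwardMap (P : RTMParams) {M : ℕ} (x : Fin M → ℝ) (t : ℝ)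
    (G : LogPerm P.xstar → DataSpace M) : Prop :=
  ∀ u, ∃ (τ : ℝ) (Υ : ℝ → ℝ) (p dp : ℝ → ℝ → ℝ), IsRTMSolution P u τ Υ p dp ∧
    G u (Sum.inl ()) = Υ (min t τ) ∧ ∀ m, G u (Sum.inr m) = p (x m) (min t τ)

/-! ### The prior -/

/-- The modified Bessel function of the second kind, `K_ν(z) = ∫_0^∞ e^{-z cosh s} cosh(ν s) ds`
for `z > 0`. -/
def besselK (ν z : ℝ) : ℝ :=
  ∫ s in Ioi (0 : ℝ), Real.exp (-z * Real.cosh s) * Real.cosh (ν * s)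

/-- The Whittle-Matern covariance function
`c(x,y) = σ₀² 2^{1-ν}/Γ(ν) (|x-y|/l)^ν K_ν(|x-y|/l)`, with its continuous extension `σ₀²` on the
diagonal. -/
def maternCov (σ₀ ν l x y : ℝ) : ℝ :=
  if x = y then σ₀ ^ 2
  else σ₀ ^ 2 * ((2 : ℝ) ^ (1 - ν) / Real.Gamma ν) * (|x - y| / l) ^ ν * besselK ν (|x - y| / l)

/-- `μ₀` is the Gaussian measure on `C[0, L]` with mean function `ubar` and covariance function
`c`. -/
structure IsGaussianPrior {L : ℝ} (ubar : LogPerm L) (c : ℝ → ℝ → ℝ)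
    (μ₀ : Measure (LogPerm L)) : Prop where
  gaussian : IsGaussian μ₀
  mean : ∀ x : Icc (0 : ℝ) L, ∫ u, u x ∂μ₀ = ubar x
  covariance : ∀ x y : Icc (0 : ℝ) L,
    cov[fun u : LogPerm L => u x, fun u : LogPerm L => u y; μ₀] = c x y

/-! ### Noise and likelihood -/

/-- The block-diagonal covariance of the noise at one observation time: variance `γ` for the front
location, covariance matrix `Γp` for the pressures. -/
def noiseCov {M : ℕ} (γ : ℝ) (Γp : Matrix (Fin M) (Fin M) ℝ) :
    Matrix (Unit ⊕ Fin M) (Unit ⊕ Fin M) ℝ :=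
  Matrix.fromBlocks (Matrix.of fun _ _ => γ) 0 0 Γp

/-- The Gaussian likelihood `a exp(-|Γ^{-1/2} (y - g)|² / 2)` of the datum `y` when the noise-free
prediction is `g`; here `|Γ^{-1/2} v|² = vᵀ Γ⁻¹ v`. -/
def likelihood {M : ℕ} (a : ℝ) (Γ : Matrix (Unit ⊕ Fin M) (Unit ⊕ Fin M) ℝ)
    (g y : DataSpace M) : ℝ :=
  a * Real.exp (-(1 / 2) * ((y - g).ofLp ⬝ᵥ (Γ⁻¹ *ᵥ (y - g).ofLp)))

/-- The first `n` observations `y_s = G_s(U) + η_s`. -/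
def observations {Ω : Type*} {L : ℝ} {M N n : ℕ} (hn : n ≤ N)
    (G : Fin N → LogPerm L → DataSpace M) (U : Ω → LogPerm L) (η : Fin N → Ω → DataSpace M)
    (ω : Ω) : Fin n → DataSpace M :=
  fun s => G (Fin.castLE hn s) (U ω) + η (Fin.castLE hn s) ω

/-- The product `∏_{s ≤ n} l_s(u, y_s)` of the first `n` likelihoods. -/
def likelihoodProd {L : ℝ} {M N n : ℕ} (hn : n ≤ N) (a : Fin N → ℝ)
    (Γ : Fin N → Matrix (Unit ⊕ Fin M) (Unit ⊕ Fin M) ℝ)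
    (G : Fin N → LogPerm L → DataSpace M) (y : Fin n → DataSpace M) (u : LogPerm L) : ℝ :=
  ∏ s : Fin n, likelihood (a (Fin.castLE hn s)) (Γ (Fin.castLE hn s)) (G (Fin.castLE hn s) u) (y s)

end

/-!
The theorem has three independent parts.

**Forward maps.** In one space dimension Darcy's law integrates explicitly: the flux is constant in
space, so that `p(x, t) = p_I - (p_I - p_0) R(x) / R(Υ(t))` behind the front, with the resistance
`R(x) = ∫₀ˣ e^{-u}`. The front equation becomes `Υ' R(Υ) = (p_I - p_0) / (φ μ)`, i.e.
`F(Υ(t)) = (p_I - p_0) t / (φ μ)` with `F = ∫₀ R`, which is strictly increasing. Inverting `F` gives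
a solution (`RTMParams.isRTMSolution`), and the same integration shows that every solution is this
one (`IsRTMSolution.front_eq`, `IsRTMSolution.pressure_eq_pressure`). Since `F` depends continuously
on `u`, the condition `Υ(t) ≤ a`, which says that `(p_I - p_0) t / (φ μ) ≤ F(a)`, is measurable in
`u`; so the forward maps are Borel measurable (`RTMParams.measurable_forwardMap`).

**Prior.** Substituting `t = (z / 2) e^s` in the integral for `K_ν` exhibits the Whittle-Matérn
covariance as a mixture of the Gaussian covariances `exp (-(x - y)² / (4 l² t))` over a
Gamma(`ν`, 1) distributed `t` (`maternCov_eq_integral`). Writing these as characteristic functions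
gives a feature map `h` into an `L²` space with `c(x, y) = ⟪h x, h y⟫` (`inner_maternFeature`),
which is Hölder continuous because the Gamma distribution has negative moments of order below `ν`
(`norm_maternFeature_sub_le`). Composing `h` with an isonormal process (`exists_isonormal`) gives a
Gaussian process whose dyadic interpolations are Cauchy in `L^p(Ω; C[0, L])` for large `p`, by the
counting argument of Kolmogorov's continuity theorem (`lintegral_approxPath_sub_le`); the law of the
limit, translated by the mean, is the prior (`exists_isGaussianPrior`). Uniqueness holds because
every continuous functional on `C[0, L]` is a pointwise limit of combinations of point evaluations,
whose Gaussian laws are determined by the mean and the covariance functions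
(`IsGaussianPrior.unique`).

**Posterior.** The noise has a positive density (`exists_multivariateGaussian_eq_withDensity`), so
the pair of data and parameter has a density proportional to the product of the likelihoods with
respect to the product of Lebesgue measure and the prior (`exists_hasLaw_observations`). The
likelihoods are positive and bounded, hence this density can be normalized in the parameter for
every value of the data, and the resulting Markov kernel disintegrates the joint law
(`hasCondDistrib_bayesKernel`). Two disintegrations over a countably generated σ-algebra agree
almost everywhere.
-/

noncomputable section

/-! ### The moving boundary problem -/

namespace RTMParams

variable (P : RTMParams) (u : LogPerm P.xstar)

/-- The hydraulic resistance `∫₀ˣ e^{-u}` of the segment `[0, x]`. -/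
def resist (x : ℝ) : ℝ := ∫ z in (0 : ℝ)..x, (P.perm u z)⁻¹

/-- The primitive `∫₀ˣ R` of the resistance `R`; the filled length `Υ` satisfies
`filling (Υ t) = rate * t`. -/
def filling (x : ℝ) : ℝ := ∫ y in (0 : ℝ)..x, P.resist u y

/-- The constant `(p_I - p_0) / (φ μ)`. -/
def rate : ℝ := (P.pI - P.p0) / (P.poros * P.visc)

variable {P}

lemma rate_pos : 0 < P.rate :=
  div_pos (sub_pos.2 P.p0_lt_pI) (mul_pos P.poros_pos P.visc_pos)

lemma perm_pos (x : ℝ) : 0 < P.perm u x := Real.exp_pos _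

lemma continuous_perm : Continuous fun q : LogPerm P.xstar × ℝ => P.perm q.1 q.2 := by
  unfold RTMParams.perm IccExtend
  have h : Continuous fun q : LogPerm P.xstar × ℝ => q.1 (projIcc 0 P.xstar P.xstar_pos.le q.2) :=
    continuous_fst.eval (continuous_projIcc.comp continuous_snd)
  exact Real.continuous_exp.comp h

lemma continuous_perm_inv : Continuous fun q : LogPerm P.xstar × ℝ => (P.perm q.1 q.2)⁻¹ :=
  continuous_perm.inv₀ fun q => (perm_pos q.1 q.2).ne'

lemma continuous_perm_inv_right : Continuous fun x => (P.perm u x)⁻¹ :=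
  continuous_perm_inv.comp (Continuous.prodMk_right u)

lemma continuous_resist : Continuous fun q : LogPerm P.xstar × ℝ => P.resist q.1 q.2 := by
  unfold resist
  exact intervalIntegral.continuous_parametric_intervalIntegral_of_continuous
    (f := fun (q : LogPerm P.xstar × ℝ) z => (P.perm q.1 z)⁻¹) (s := fun q => q.2)
    (continuous_perm_inv.comp ((continuous_fst.comp continuous_fst).prodMk continuous_snd))
    continuous_snd

lemma continuous_resist_right : Continuous (P.resist u) :=
  continuous_resist.comp (Continuous.prodMk_right u)

lemma continuous_filling : Continuous fun q : LogPerm P.xstar × ℝ => P.filling q.1 q.2 := by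
  unfold filling
  exact intervalIntegral.continuous_parametric_intervalIntegral_of_continuous
    (f := fun (q : LogPerm P.xstar × ℝ) z => P.resist q.1 z) (s := fun q => q.2)
    (continuous_resist.comp ((continuous_fst.comp continuous_fst).prodMk continuous_snd))
    continuous_snd

lemma continuous_filling_right : Continuous (P.filling u) :=
  continuous_filling.comp (Continuous.prodMk_right u)

lemma hasDerivAt_resist (x : ℝ) : HasDerivAt (P.resist u) (P.perm u x)⁻¹ x :=
  (continuous_perm_inv_right u).integral_hasStrictDerivAt 0 x |>.hasDerivAt

lemma hasDerivAt_filling (x : ℝ) : HasDerivAt (P.filling u) (P.resist u x) x :=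
  (continuous_resist_right u).integral_hasStrictDerivAt 0 x |>.hasDerivAt

@[simp] lemma resist_zero : P.resist u 0 = 0 := by simp [resist]

@[simp] lemma filling_zero : P.filling u 0 = 0 := by simp [filling]

lemma resist_strictMono : StrictMono (P.resist u) :=
  strictMono_of_hasDerivAt_pos (hasDerivAt_resist u) fun x => inv_pos.2 (perm_pos u x)

lemma resist_pos {x : ℝ} (hx : 0 < x) : 0 < P.resist u x := by
  simpa using resist_strictMono u hx

lemma filling_strictMonoOn : StrictMonoOn (P.filling u) (Ici 0) := by
  refine strictMonoOn_of_deriv_pos (convex_Ici 0) (continuous_filling_right u).continuousOn ?_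
  intro x hx
  rw [interior_Ici] at hx
  rw [(hasDerivAt_filling u x).deriv]
  exact resist_pos u hx

lemma filling_pos {x : ℝ} (hx : 0 < x) : 0 < P.filling u x := by
  simpa using filling_strictMonoOn u (mem_Ici.2 le_rfl) (mem_Ici.2 hx.le) hx

variable (P) in
/-- Projection of the line onto `[0, xstar]`. -/
def clamp (x : ℝ) : ℝ := max 0 (min x P.xstar)

lemma clamp_mem (x : ℝ) : P.clamp x ∈ Icc 0 P.xstar :=
  ⟨le_max_left _ _, max_le P.xstar_pos.le (min_le_right _ _)⟩

lemma clamp_of_mem {x : ℝ} (hx : x ∈ Icc 0 P.xstar) : P.clamp x = x := by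
  simp [clamp, hx.1, hx.2]

variable (P) in
/-- The filling function on `[0, xstar]`, continued with slope `1` to a homeomorphism of the
line. -/
def fillingExt (x : ℝ) : ℝ := P.filling u (P.clamp x) + (x - P.clamp x)

lemma fillingExt_of_mem {x : ℝ} (hx : x ∈ Icc 0 P.xstar) : P.fillingExt u x = P.filling u x := by
  simp [fillingExt, clamp_of_mem hx]

lemma continuous_fillingExt : Continuous (P.fillingExt u) := by
  have h : Continuous P.clamp := by unfold clamp; fun_prop
  exact ((continuous_filling_right u).comp h).add (continuous_id.sub h)

lemma fillingExt_strictMono : StrictMono (P.fillingExt u) := by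
  intro x y hxy
  have hc : P.clamp x ≤ P.clamp y := by unfold clamp; gcongr
  have hd : x - P.clamp x ≤ y - P.clamp y := by
    unfold clamp
    have := P.xstar_pos
    rcases max_cases 0 (min x P.xstar) with h | h
      <;> rcases max_cases 0 (min y P.xstar) with h' | h'
      <;> rcases min_cases x P.xstar with h1 | h1 <;> rcases min_cases y P.xstar with h2 | h2
      <;> linarith
  unfold fillingExt
  rcases hc.eq_or_lt with h | h
  · rw [h]; linarith
  · have := filling_strictMonoOn u (clamp_mem x).1 (clamp_mem y).1 h
    linarith

lemma fillingExt_surjective : Function.Surjective (P.fillingExt u) := by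
  have hmono := (filling_strictMonoOn u).monotoneOn
  refine (continuous_fillingExt u).surjective ?_ ?_
  · refine Filter.tendsto_atTop_mono (f := fun x => x - P.xstar) (fun x => ?_)
      (Filter.tendsto_atTop_add_const_right _ _ Filter.tendsto_id)
    have h0 := hmono (mem_Ici.2 le_rfl) (clamp_mem (P := P) x).1 (clamp_mem (P := P) x).1
    have := (clamp_mem (P := P) x).2
    simp only [filling_zero, fillingExt] at h0 ⊢
    linarith
  · refine Filter.tendsto_atBot_mono (f := fun x => x + P.filling u P.xstar) (fun x => ?_)
      (Filter.tendsto_atBot_add_const_right _ _ Filter.tendsto_id)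
    have h0 := hmono (clamp_mem (P := P) x).1 (mem_Ici.2 P.xstar_pos.le) (clamp_mem (P := P) x).2
    have := (clamp_mem (P := P) x).1
    simp only [fillingExt] at h0 ⊢
    linarith

variable (P) in
/-- The extended filling function as an order isomorphism of the line. -/
def fillingIso : ℝ ≃o ℝ :=
  (fillingExt_strictMono u).orderIsoOfSurjective _ (fillingExt_surjective u)

lemma fillingIso_apply (x : ℝ) : P.fillingIso u x = P.fillingExt u x := rfl

variable (P) in
/-- The front location at time `t`. -/
def front (t : ℝ) : ℝ := (P.fillingIso u).symm (P.rate * t)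

variable (P) in
/-- The time at which the front reaches `xstar`. -/
def fillingTime : ℝ := P.filling u P.xstar / P.rate

lemma fillingTime_pos : 0 < P.fillingTime u := div_pos (filling_pos u P.xstar_pos) rate_pos

lemma rate_mul_fillingTime : P.rate * P.fillingTime u = P.filling u P.xstar :=
  mul_div_cancel₀ _ rate_pos.ne'

lemma front_eq_of_filling_eq {t y : ℝ} (hy : y ∈ Icc 0 P.xstar)
    (h : P.filling u y = P.rate * t) : P.front u t = y := by
  unfold front
  rw [← h, ← fillingExt_of_mem u hy]
  exact (P.fillingIso u).symm_apply_apply y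

lemma front_zero : P.front u 0 = 0 :=
  front_eq_of_filling_eq u ⟨le_rfl, P.xstar_pos.le⟩ (by simp)

lemma front_fillingTime : P.front u (P.fillingTime u) = P.xstar :=
  front_eq_of_filling_eq u ⟨P.xstar_pos.le, le_rfl⟩ (rate_mul_fillingTime u).symm

lemma front_strictMono : StrictMono (P.front u) :=
  (P.fillingIso u).symm.strictMono.comp (strictMono_mul_left_of_pos rate_pos)

lemma continuous_front : Continuous (P.front u) :=
  (P.fillingIso u).symm.continuous.comp (continuous_const.mul continuous_id)

lemma hasDerivAt_front {t : ℝ} (ht : t ∈ Ioo 0 (P.fillingTime u)) :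
    HasDerivAt (P.front u) (P.rate / P.resist u (P.front u t)) t := by
  have h0 : 0 < P.front u t := by simpa [front_zero] using front_strictMono u ht.1
  have h1 : P.front u t < P.xstar := by simpa [front_fillingTime] using front_strictMono u ht.2
  have hf : HasDerivAt (P.fillingExt u) (P.resist u (P.front u t)) (P.front u t) := by
    refine (hasDerivAt_filling u _).congr_of_eventuallyEq ?_
    filter_upwards [Ioo_mem_nhds h0 h1] with y hy
    exact fillingExt_of_mem u ⟨hy.1.le, hy.2.le⟩
  have hg : HasDerivAt (P.fillingIso u).symm (P.resist u (P.front u t))⁻¹ (P.rate * t) :=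
    HasDerivAt.of_local_left_inverse (P.fillingIso u).symm.continuous.continuousAt hf
      (resist_pos u h0).ne' (Filter.Eventually.of_forall (P.fillingIso u).apply_symm_apply)
  have := hg.comp t ((hasDerivAt_id t).const_mul P.rate)
  exact this.congr_deriv (by simp [div_eq_inv_mul])

variable (P) in
/-- The pressure at the point `x` when the front is at `y`. -/
def pressure (y x : ℝ) : ℝ :=
  if x ≤ 0 then P.pI else if y ≤ x then P.p0
  else P.pI - (P.pI - P.p0) * (P.resist u x / P.resist u y)

lemma pressure_of_mem {x y : ℝ} (hy : 0 < y) (hx : x ∈ Icc 0 y) :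
    P.pressure u y x = P.pI - (P.pI - P.p0) * (P.resist u x / P.resist u y) := by
  unfold pressure
  split_ifs with h1 h2
  · simp [le_antisymm h1 hx.1]
  · simp [le_antisymm hx.2 h2, (resist_pos u hy).ne']
  · rfl

lemma hasDerivAt_pressure_formula (x y : ℝ) :
    HasDerivAt (fun x => P.pI - (P.pI - P.p0) * (P.resist u x / P.resist u y))
      (-((P.pI - P.p0) * ((P.perm u x)⁻¹ / P.resist u y))) x :=
  ((hasDerivAt_resist u x).div_const _).const_mul _ |>.const_sub _

/-- Existence for the moving boundary problem. -/
theorem isRTMSolution : IsRTMSolution P u (P.fillingTime u) (P.front u)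
    (fun x t => P.pressure u (P.front u t) x)
    (fun x t => -((P.pI - P.p0) * ((P.perm u x)⁻¹ / P.resist u (P.front u t)))) := by
  have hpos : ∀ {t}, 0 < t → 0 < P.front u t := fun ht => by
    simpa [front_zero] using front_strictMono u ht
  have hne : ∀ {t}, 0 < t → P.resist u (P.front u t) ≠ 0 := fun ht => (resist_pos u (hpos ht)).ne'
  have hv := P.visc_pos.ne'
  have hφ := P.poros_pos.ne'
  exact
  { filling_pos := fillingTime_pos u
    front_filling := front_fillingTime u
    front_zero := front_zero u
    front_continuous := (continuous_front u).continuousOn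
    front_pos := fun t ht => hpos ht.1
    front_lt := fun t ht => by simpa [front_fillingTime] using front_strictMono u ht.2
    pressure_deriv := fun t ht x hx => by
      refine (hasDerivAt_pressure_formula u x _).congr_of_eventuallyEq ?_
      filter_upwards [Ioo_mem_nhds hx.1 hx.2] with y hy
      exact pressure_of_mem u (hpos ht.1) ⟨hy.1.le, hy.2.le⟩
    darcy := fun t ht x hx => by
      have : (fun ξ => 1 / P.visc * P.perm u ξ *
          -((P.pI - P.p0) * ((P.perm u ξ)⁻¹ / P.resist u (P.front u t)))) =
          fun _ => -(1 / P.visc * ((P.pI - P.p0) / P.resist u (P.front u t))) := by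
        ext ξ
        have := (perm_pos u ξ).ne'
        field_simp
      rw [this]
      exact hasDerivAt_const _ _
    pressure_continuous := fun t ht => by
      refine ContinuousOn.congr (f := fun x =>
        P.pI - (P.pI - P.p0) * (P.resist u x / P.resist u (P.front u t))) ?_
        fun x hx => pressure_of_mem u (hpos ht.1) hx
      exact fun x _ => (hasDerivAt_pressure_formula u x _).continuousAt.continuousWithinAt
    pressure_deriv_front := fun t ht => by
      refine (hasDerivAt_pressure_formula u _ _).hasDerivWithinAt.congr_of_eventuallyEq ?_
        (pressure_of_mem u (hpos ht.1) ⟨(hpos ht.1).le, le_rfl⟩)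
      filter_upwards [inter_mem_nhdsWithin _ (Ioi_mem_nhds (hpos ht.1))] with y hy
      exact pressure_of_mem u (hpos ht.1) ⟨le_of_lt hy.2, hy.1⟩
    front_velocity := fun t ht => by
      refine (hasDerivAt_front u ht).congr_deriv ?_
      have := (perm_pos u (P.front u t)).ne'
      have := hne ht.1
      simp only [rate]
      field_simp
    pressure_initial := fun x hx => by
      simp [pressure, not_le.2 hx.1, front_zero, hx.1.le]
    pressure_inlet := fun t ht => by simp [pressure]
    pressure_outside := fun t ht x hx => by
      simp [pressure, not_le.2 ((hpos ht.1).trans_le hx.1), hx.1] }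

end RTMParams

/-- A continuous function on `[a, b]` with derivative `c` in the interior is affine there. -/
lemma eq_add_mul_of_hasDerivAt_Ioo {f : ℝ → ℝ} {a b c : ℝ} (hf : ContinuousOn f (Icc a b))
    (hd : ∀ x ∈ Ioo a b, HasDerivAt f c x) {x : ℝ} (hx : x ∈ Icc a b) :
    f x = f a + c * (x - a) := by
  rcases hx.1.eq_or_lt with rfl | h
  · simp
  · obtain ⟨y, hy, h'⟩ := exists_hasDerivAt_eq_slope f (fun _ => c) h
      (hf.mono (Icc_subset_Icc_right hx.2)) fun y hy => hd y ⟨hy.1, hy.2.trans_le hx.2⟩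
    rw [h', div_mul_cancel₀ _ (sub_pos.2 h).ne']
    ring

namespace IsRTMSolution

open RTMParams

variable {P : RTMParams} {u : LogPerm P.xstar} {τ : ℝ} {Υ : ℝ → ℝ} {p dp : ℝ → ℝ → ℝ}

/-- Darcy's law and mass conservation determine the pressure behind the front. -/
lemma pressure_eq (h : IsRTMSolution P u τ Υ p dp) {t : ℝ} (ht : t ∈ Ioc 0 τ) {x : ℝ}
    (hx : x ∈ Icc 0 (Υ t)) :
    p x t = P.pI - (P.pI - P.p0) * (P.resist u x / P.resist u (Υ t)) := by
  have hΥ := h.front_pos t ht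
  have hR := (resist_pos u hΥ).ne'
  have hv := P.visc_pos.ne'
  -- the flux is constant in space
  obtain ⟨c, hc⟩ : ∃ c, ∀ y ∈ Ioo 0 (Υ t), 1 / P.visc * P.perm u y * dp y t = c := by
    have hz : Υ t / 2 ∈ Ioo 0 (Υ t) := ⟨by linarith, by linarith⟩
    refine ⟨1 / P.visc * P.perm u (Υ t / 2) * dp (Υ t / 2) t, fun y hy => ?_⟩
    refine isOpen_Ioo.is_const_of_deriv_eq_zero (s := Ioo 0 (Υ t))
      (f := fun y => 1 / P.visc * P.perm u y * dp y t) isPreconnected_Ioo ?_ ?_ hy hz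
    · exact fun z hz => (h.darcy t ht z hz).differentiableAt.differentiableWithinAt
    · exact fun z hz => (h.darcy t ht z hz).deriv
  have hformula : ∀ y ∈ Icc 0 (Υ t), p y t = P.pI + c * P.visc * P.resist u y := by
    intro y hy
    have := eq_add_mul_of_hasDerivAt_Ioo (f := fun y => p y t - c * P.visc * P.resist u y)
      (a := 0) (b := Υ t) (c := 0)
      ((h.pressure_continuous t ht).sub
        (continuous_const.mul (continuous_resist_right u)).continuousOn) (fun z hz => ?_) hy
    · have hin := h.pressure_inlet t ⟨ht.1.le, ht.2⟩
      simp only [resist_zero, hin] at this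
      linarith
    · have := (h.pressure_deriv t ht z hz).sub ((hasDerivAt_resist u z).const_mul (c * P.visc))
      refine this.congr_deriv ?_
      rw [← hc z hz]
      have := (perm_pos u z).ne'
      field_simp
      ring
  have hxs : Υ t ≤ P.xstar := by
    rcases ht.2.eq_or_lt with h' | h'
    · rw [h', h.front_filling]
    · exact (h.front_lt t ⟨ht.1.le, h'⟩).le
  have h1 := hformula (Υ t) ⟨hΥ.le, le_rfl⟩
  rw [h.pressure_outside t ht (Υ t) ⟨le_rfl, hxs⟩] at h1
  rw [hformula x hx]
  have : c * P.visc = -((P.pI - P.p0) / P.resist u (Υ t)) := by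
    field_simp
    linarith
  rw [this]
  ring

lemma front_mem (h : IsRTMSolution P u τ Υ p dp) {t : ℝ} (ht : t ∈ Icc 0 τ) :
    Υ t ∈ Icc 0 P.xstar := by
  constructor
  · rcases ht.1.eq_or_lt with h' | h'
    · rw [← h', h.front_zero]
    · exact (h.front_pos t ⟨h', ht.2⟩).le
  · rcases ht.2.eq_or_lt with h' | h'
    · rw [h', h.front_filling]
    · exact (h.front_lt t ⟨ht.1, h'⟩).le

/-- The front equation integrates to `filling (Υ t) = rate * t`. -/
lemma filling_front (h : IsRTMSolution P u τ Υ p dp) {t : ℝ} (ht : t ∈ Icc 0 τ) :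
    P.filling u (Υ t) = P.rate * t := by
  have := eq_add_mul_of_hasDerivAt_Ioo (f := fun s => P.filling u (Υ s)) (a := 0) (b := τ)
    (c := P.rate) ((continuous_filling_right u).comp_continuousOn h.front_continuous) ?_ ht
  · simpa [h.front_zero] using this
  intro s hs
  have hs' : s ∈ Ioc 0 τ := ⟨hs.1, hs.2.le⟩
  have hΥ := h.front_pos s hs'
  have hR := (resist_pos u hΥ).ne'
  have hdp : dp (Υ s) s = -((P.pI - P.p0) * ((P.perm u (Υ s))⁻¹ / P.resist u (Υ s))) := by
    refine (uniqueDiffOn_Iic (Υ s) _ (mem_Iic.2 le_rfl)).eq_deriv _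
      (h.pressure_deriv_front s hs') ?_
    refine (hasDerivAt_pressure_formula u _ _).hasDerivWithinAt.congr_of_eventuallyEq ?_
      (h.pressure_eq hs' ⟨hΥ.le, le_rfl⟩)
    filter_upwards [inter_mem_nhdsWithin _ (Ioi_mem_nhds hΥ)] with y hy
    exact h.pressure_eq hs' ⟨le_of_lt hy.2, hy.1⟩
  have h2 := (hasDerivAt_filling u (Υ s)).comp s (h.front_velocity s hs)
  refine h2.congr_deriv ?_
  have := (perm_pos u (Υ s)).ne'
  have hv := P.visc_pos.ne'
  have hφ := P.poros_pos.ne'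
  rw [hdp, rate]
  field_simp

lemma filling_time_eq (h : IsRTMSolution P u τ Υ p dp) : τ = P.fillingTime u := by
  have := h.filling_front ⟨h.filling_pos.le, le_rfl⟩
  rw [h.front_filling] at this
  rw [fillingTime, this, mul_div_cancel_left₀ _ rate_pos.ne']

lemma front_eq (h : IsRTMSolution P u τ Υ p dp) {t : ℝ} (ht : t ∈ Icc 0 τ) :
    Υ t = P.front u t :=
  (front_eq_of_filling_eq u (h.front_mem ht) (h.filling_front ht)).symm

lemma pressure_eq_pressure (h : IsRTMSolution P u τ Υ p dp) {t : ℝ} (ht : t ∈ Ioc 0 τ) {x : ℝ}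
    (hx : x ∈ Icc 0 P.xstar) : p x t = P.pressure u (P.front u t) x := by
  rw [← h.front_eq ⟨ht.1.le, ht.2⟩]
  rcases le_total x (Υ t) with h' | h'
  · rw [h.pressure_eq ht ⟨hx.1, h'⟩, pressure_of_mem u (h.front_pos t ht) ⟨hx.1, h'⟩]
  · rw [h.pressure_outside t ht x ⟨h', hx.2⟩, pressure, if_neg, if_pos h']
    exact not_le.2 ((h.front_pos t ht).trans_le h')

end IsRTMSolution

namespace RTMParams

variable {P : RTMParams} {M : ℕ}

variable (P) in
/-- The front location and the sensor pressures at the time `t ∧ τ`. -/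
def forwardMap (x : Fin M → ℝ) (t : ℝ) (u : LogPerm P.xstar) : DataSpace M :=
  WithLp.toLp 2 (Sum.elim (fun _ => P.front u (min t (P.fillingTime u)))
    fun m => P.pressure u (P.front u (min t (P.fillingTime u))) (x m))

lemma isForwardMap_forwardMap (x : Fin M → ℝ) (t : ℝ) :
    IsForwardMap P x t (P.forwardMap x t) := fun u =>
  ⟨_, _, _, _, P.isRTMSolution u, rfl, fun _ => rfl⟩

lemma eq_forwardMap {x : Fin M → ℝ} (hx : ∀ m, x m ∈ Icc 0 P.xstar) {t : ℝ} (ht : 0 < t)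
    {G : LogPerm P.xstar → DataSpace M} (hG : IsForwardMap P x t G) : G = P.forwardMap x t := by
  ext u i
  obtain ⟨τ, Υ, p, dp, h, h1, h2⟩ := hG u
  have hτ := h.filling_time_eq
  have hmin : min t τ ∈ Ioc 0 τ := ⟨lt_min ht h.filling_pos, min_le_right _ _⟩
  rcases i with i | m
  · rw [h1, h.front_eq ⟨hmin.1.le, hmin.2⟩, hτ]
    rfl
  · rw [h2, h.pressure_eq_pressure hmin (hx m), hτ]
    rfl

lemma measurable_front (t : ℝ) :
    Measurable fun u : LogPerm P.xstar => P.front u (min t (P.fillingTime u)) := by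
  refine measurable_of_Iic fun a => ?_
  -- `front u s ≤ a` says `rate * s ≤ fillingExt u a`, whose right side is continuous in `u`
  have : (fun u : LogPerm P.xstar => P.front u (min t (P.fillingTime u))) ⁻¹' Iic a =
      {u | min (P.rate * t) (P.filling u P.xstar) ≤ P.fillingExt u a} := by
    ext u
    rw [mem_preimage, mem_Iic, front, OrderIso.symm_apply_le, fillingIso_apply,
      mul_min_of_nonneg _ _ rate_pos.le, rate_mul_fillingTime, mem_ofPred_eq]
  rw [this]
  have hc : ∀ b, Continuous fun u : LogPerm P.xstar => P.filling u b := fun b =>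
    continuous_filling.comp (Continuous.prodMk_left b)
  exact measurableSet_le (continuous_const.min (hc _)).measurable
    ((hc _).add continuous_const).measurable

lemma measurable_forwardMap (x : Fin M → ℝ) (t : ℝ) : Measurable (P.forwardMap x t) := by
  refine (PiLp.continuous_toLp 2 _).measurable.comp (measurable_pi_lambda _ fun i => ?_)
  rcases i with i | m
  · exact measurable_front t
  · simp only [Sum.elim_inr]
    unfold pressure
    refine Measurable.ite (by simp) measurable_const ?_
    refine Measurable.ite (measurableSet_le (measurable_front t) measurable_const)
      measurable_const ?_
    have hR : ∀ f : LogPerm P.xstar → ℝ, Measurable f → Measurable fun u => P.resist u (f u) :=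
      fun f hf => continuous_resist.measurable.comp (measurable_id.prodMk hf)
    exact measurable_const.sub (measurable_const.mul
      ((hR _ measurable_const).div (hR _ (measurable_front t))))

end RTMParams

/-! ### Isonormal Gaussian processes -/

section Isonormal

variable {Ω : Type*} [MeasurableSpace Ω] {Pr : Measure Ω}

lemma norm_exp_mul_I_sub_le (a b : ℝ) :
    ‖Complex.exp (a * Complex.I) - Complex.exp (b * Complex.I)‖ ≤ |a - b| := by
  have h : Complex.exp (a * Complex.I) - Complex.exp (b * Complex.I) =
      Complex.exp (b * Complex.I) * (Complex.exp (Complex.I * ((a - b : ℝ) : ℂ)) - 1) := by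
    rw [mul_sub, ← Complex.exp_add, mul_one]
    congr 2
    push_cast
    ring
  rw [h, norm_mul, Complex.norm_exp_ofReal_mul_I, one_mul]
  exact Real.norm_exp_I_mul_ofReal_sub_one_le

lemma charFun_map_eq_integral [IsFiniteMeasure Pr] {f : Ω → ℝ} (hf : AEMeasurable f Pr) (t : ℝ) :
    charFun (Pr.map f) t = ∫ ω, Complex.exp (((t * f ω : ℝ) : ℂ) * Complex.I) ∂Pr := by
  rw [charFun_apply_real, integral_map hf (by fun_prop)]
  simp

lemma integrable_exp_mul_I [IsFiniteMeasure Pr] {f : Ω → ℝ} (hf : AEStronglyMeasurable f Pr) :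
    Integrable (fun ω => Complex.exp ((f ω : ℂ) * Complex.I)) Pr := by
  refine Integrable.of_bound (C := 1) ?_ (Filter.Eventually.of_forall fun ω => ?_)
  · exact (by fun_prop : Continuous fun x : ℝ => Complex.exp ((x : ℂ) * Complex.I))
      |>.comp_aestronglyMeasurable hf
  · rw [Complex.norm_exp_ofReal_mul_I]

lemma integral_norm_le_norm_Lp_two [IsProbabilityMeasure Pr] (f : Lp ℝ 2 Pr) :
    ∫ ω, |f ω| ∂Pr ≤ ‖f‖ := by
  have h1 : ∫ ω, |f ω| ∂Pr = (eLpNorm f 1 Pr).toReal := by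
    rw [eLpNorm_one_eq_lintegral_enorm, ← integral_norm_eq_lintegral_enorm
      (Lp.aestronglyMeasurable f)]
    rfl
  rw [h1, Lp.norm_def]
  exact ENNReal.toReal_mono (Lp.eLpNorm_ne_top f)
    (eLpNorm_le_eLpNorm_of_exponent_le one_le_two (Lp.aestronglyMeasurable f))

/-- The characteristic function of the law depends continuously on the random variable in `L²`. -/
lemma continuous_charFun_map_Lp [IsProbabilityMeasure Pr] (t : ℝ) :
    Continuous fun f : Lp ℝ 2 Pr => charFun (Pr.map f) t := by
  refine (LipschitzWith.of_dist_le_mul (K := ‖t‖₊) fun f g => ?_).continuous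
  have hf := Lp.aestronglyMeasurable f
  have hg := Lp.aestronglyMeasurable g
  rw [dist_eq_norm, dist_eq_norm, charFun_map_eq_integral hf.aemeasurable,
    charFun_map_eq_integral hg.aemeasurable,
    ← integral_sub (integrable_exp_mul_I (hf.const_mul t)) (integrable_exp_mul_I (hg.const_mul t))]
  calc _ ≤ ∫ ω, |t| * |(f - g) ω| ∂Pr := by
        refine norm_integral_le_of_norm_le
          (((Lp.memLp (f - g)).integrable one_le_two).abs.const_mul _) ?_
        filter_upwards [Lp.coeFn_sub f g] with ω hω
        rw [hω, Pi.sub_apply, ← abs_mul, mul_sub]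
        exact norm_exp_mul_I_sub_le _ _
    _ = |t| * ∫ ω, |(f - g) ω| ∂Pr := integral_const_mul _ _
    _ ≤ _ := mul_le_mul_of_nonneg_left (integral_norm_le_norm_Lp_two _) (abs_nonneg t)

/-- `f` is a centred Gaussian random variable; its variance is then its squared `L²` norm. The law
is the Dirac mass at `0` when `f = 0`. -/
def IsCentredGaussian (f : Lp ℝ 2 Pr) : Prop :=
  Pr.map f = gaussianReal 0 (‖f‖₊ ^ 2)

lemma isCentredGaussian_iff [IsProbabilityMeasure Pr] {f : Lp ℝ 2 Pr} :
    IsCentredGaussian f ↔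
      ∀ t : ℝ, charFun (Pr.map f) t = Complex.exp (-((‖f‖ ^ 2 * t ^ 2 / 2 : ℝ) : ℂ)) := by
  have h : ∀ t : ℝ, charFun (gaussianReal 0 (‖f‖₊ ^ 2)) t =
      Complex.exp (-((‖f‖ ^ 2 * t ^ 2 / 2 : ℝ) : ℂ)) := fun t => by
    rw [charFun_gaussianReal]; simp
  have : IsProbabilityMeasure (Pr.map f) :=
    Measure.isProbabilityMeasure_map (Lp.aestronglyMeasurable f).aemeasurable
  constructor
  · intro hf t
    rw [hf, h]
  · intro hf
    exact Measure.ext_of_charFun (funext fun t => (hf t).trans (h t).symm)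

lemma isClosed_isCentredGaussian [IsProbabilityMeasure Pr] :
    IsClosed {f : Lp ℝ 2 Pr | IsCentredGaussian f} := by
  simp only [isCentredGaussian_iff, ofPred_forall]
  exact isClosed_iInter fun t => isClosed_eq (continuous_charFun_map_Lp t) (by fun_prop)

/-- The law on `ι → ℝ` of independent standard normal variables indexed by `ι`. -/
abbrev gaussianProduct (ι : Type*) : Measure (ι → ℝ) :=
  Measure.infinitePi fun _ => gaussianReal 0 1

variable {ι : Type*}

lemma memLp_eval_gaussianProduct (i : ι) :
    MemLp (fun ω : ι → ℝ => ω i) 2 (gaussianProduct ι) := by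
  have h := memLp_id_gaussianReal' (μ := 0) (v := 1) 2 (by norm_num)
  exact h.comp_measurePreserving (measurePreserving_eval_infinitePi _ i)

lemma iIndepFun_eval_gaussianProduct :
    iIndepFun (fun (i : ι) (ω : ι → ℝ) => ω i) (gaussianProduct ι) :=
  iIndepFun_infinitePi (X := fun _ => id) fun _ => measurable_id

/-- The `i`-th coordinate as an element of `L²`. -/
def gaussianCoord (i : ι) : Lp ℝ 2 (gaussianProduct ι) := (memLp_eval_gaussianProduct i).toLp _

lemma map_mul_eval_gaussianProduct (c : ℝ) (i : ι) :
    (gaussianProduct ι).map (fun ω => c * ω i) = gaussianReal 0 (‖c‖₊ ^ 2) := by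
  have h := (measurePreserving_eval_infinitePi (fun _ : ι => gaussianReal 0 1) i).hasLaw
  rw [(gaussianReal_const_mul h c).map_eq]
  congr 1
  · simp
  · ext; simp

lemma orthonormal_gaussianCoord : Orthonormal ℝ (gaussianCoord (ι := ι)) := by
  classical
  have hmean : ∀ i : ι, ∫ ω, ω i ∂gaussianProduct ι = 0 := fun i => by
    have h := (measurePreserving_eval_infinitePi (fun _ : ι => gaussianReal 0 1) i).hasLaw
    rw [h.integral_eq, integral_id_gaussianReal]
  rw [orthonormal_iff_ite]
  intro i j
  have h : inner ℝ (gaussianCoord i) (gaussianCoord j) =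
      ∫ ω, ω i * ω j ∂gaussianProduct ι := by
    rw [L2.inner_def]
    refine integral_congr_ae ?_
    filter_upwards [(memLp_eval_gaussianProduct i).coeFn_toLp,
      (memLp_eval_gaussianProduct j).coeFn_toLp] with ω h1 h2
    simp only [gaussianCoord, h1, h2]
    simp [mul_comm]
  rw [h]
  split_ifs with hij
  · subst hij
    have h := (measurePreserving_eval_infinitePi (fun _ : ι => gaussianReal 0 1) i).hasLaw
    have h2 := h.variance_eq
    rw [variance_id_gaussianReal, variance_eq_sub (memLp_eval_gaussianProduct i), hmean] at h2
    simpa [pow_two] using h2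
  · have := (iIndepFun_eval_gaussianProduct (ι := ι)).indepFun hij
    rw [this.integral_fun_mul_eq_mul_integral
      (memLp_eval_gaussianProduct i).1 (memLp_eval_gaussianProduct j).1, hmean, zero_mul]

lemma isCentredGaussian_sum (s : Finset ι) (c : ι → ℝ) :
    IsCentredGaussian (∑ i ∈ s, c i • gaussianCoord i) := by
  rw [isCentredGaussian_iff]
  intro t
  have hnorm : ‖∑ i ∈ s, c i • gaussianCoord i‖ ^ 2 = ∑ i ∈ s, c i ^ 2 := by
    rw [← real_inner_self_eq_norm_sq, orthonormal_gaussianCoord.inner_sum]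
    simp [pow_two]
  have hae : (∑ i ∈ s, c i • gaussianCoord i : Lp ℝ 2 (gaussianProduct ι)) =ᵐ[gaussianProduct ι]
      fun ω => ∑ i ∈ s, c i * ω i := by
    have h : ∀ᵐ ω ∂gaussianProduct ι, ∀ i ∈ s,
        (c i • gaussianCoord i : Lp ℝ 2 (gaussianProduct ι)) ω = c i * ω i := by
      rw [Finset.eventually_all]
      intro i _
      filter_upwards [Lp.coeFn_smul (c i) (gaussianCoord i),
        (memLp_eval_gaussianProduct i).coeFn_toLp] with ω h1 h2
      rw [h1, Pi.smul_apply, gaussianCoord, h2, smul_eq_mul]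
    filter_upwards [Lp.coeFn_finsetSum s fun i => c i • gaussianCoord i, h] with ω h1 h2
    rw [h1, Finset.sum_apply]
    exact Finset.sum_congr rfl h2
  have hmeas : ∀ i, AEMeasurable (fun ω : ι → ℝ => c i * ω i) (gaussianProduct ι) := fun i =>
    (measurable_const.mul (measurable_pi_apply i)).aemeasurable
  have hind : iIndepFun (fun (i : ι) (ω : ι → ℝ) => c i * ω i) (gaussianProduct ι) :=
    iIndepFun_infinitePi (X := fun i x => c i * x) fun _ => by fun_prop
  rw [Measure.map_congr hae, (hind.restrict s).charFun_map_fun_finsetSum_eq_prod fun i _ => hmeas i,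
    Finset.prod_apply, hnorm, Finset.sum_mul, Finset.sum_div, Complex.ofReal_sum,
    ← Finset.sum_neg_distrib, Complex.exp_sum]
  refine Finset.prod_congr rfl fun i _ => ?_
  rw [map_mul_eval_gaussianProduct, charFun_gaussianReal]
  simp

/-- The isonormal process over a real Hilbert space: a linear isometry into the `L²` space of some
probability space all of whose values are centred Gaussian variables. -/
theorem exists_isonormal.{v} (H : Type v) [NormedAddCommGroup H] [InnerProductSpace ℝ H]
    [CompleteSpace H] :
    ∃ (ι : Type v) (W : H →ₗᵢ[ℝ] Lp ℝ 2 (gaussianProduct ι)), ∀ h, IsCentredGaussian (W h) := by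
  obtain ⟨w, b, -⟩ := exists_hilbertBasis ℝ H
  classical
  obtain ⟨V, hV⟩ : ∃ V : lp (fun _ : w => ℝ) 2 →ₗᵢ[ℝ] Lp ℝ 2 (gaussianProduct w),
      ∀ i, V (lp.single 2 i 1) = gaussianCoord i :=
    ⟨orthonormal_gaussianCoord.orthogonalFamily.linearIsometry, fun i => by
      rw [OrthogonalFamily.linearIsometry_apply_single]
      simp⟩
  let W : H →ₗᵢ[ℝ] Lp ℝ 2 (gaussianProduct w) := V.comp b.repr.toLinearIsometry
  have hW : ∀ i, W (b i) = gaussianCoord i := fun i => by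
    rw [← hV, ← b.repr_self]
    rfl
  refine ⟨w, W, fun h => ?_⟩
  have hcl : IsClosed {h | IsCentredGaussian (W h)} :=
    isClosed_isCentredGaussian.preimage W.continuous
  have hdense : closure (Submodule.span ℝ (range b) : Set H) = univ := by
    rw [← Submodule.topologicalClosure_coe, b.dense_span]; rfl
  refine hcl.closure_subset_iff.2 ?_ (hdense.symm ▸ mem_univ h)
  intro g hg
  obtain ⟨c, rfl⟩ := Finsupp.mem_span_range_iff_exists_finsupp.1 hg
  have : W (c.sum fun i a => a • b i) = ∑ i ∈ c.support, c i • gaussianCoord i := by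
    simp [Finsupp.sum, hW]
  rw [mem_ofPred_eq, this]
  exact isCentredGaussian_sum _ _

end Isonormal

/-! ### Interpolation on dyadic grids -/

section Interpolation

/-- A convex combination of vectors in a ball lies in that ball; only the vectors with a nonzero
weight matter. -/
lemma norm_sum_smul_le_of_weights {ι E : Type*} [SeminormedAddCommGroup E] [NormedSpace ℝ E]
    {s : Finset ι} {w : ι → ℝ} {a : ι → E} {ε : ℝ} (h0 : ∀ i ∈ s, 0 ≤ w i)
    (h1 : ∑ i ∈ s, w i = 1) (ha : ∀ i ∈ s, w i ≠ 0 → ‖a i‖ ≤ ε) : ‖∑ i ∈ s, w i • a i‖ ≤ ε := by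
  calc ‖∑ i ∈ s, w i • a i‖ ≤ ∑ i ∈ s, ‖w i • a i‖ := norm_sum_le _ _
    _ ≤ ∑ i ∈ s, w i * ε := Finset.sum_le_sum fun i hi => by
        rw [norm_smul, Real.norm_of_nonneg (h0 i hi)]
        by_cases hw : w i = 0
        · simp [hw]
        · exact mul_le_mul_of_nonneg_left (ha i hi hw) (h0 i hi)
    _ = ε := by rw [← Finset.sum_mul, h1, one_mul]

variable {L : ℝ} (hL : 0 < L)

/-- The grid point `k L / 2ⁿ` of `[0, L]` (projected to the interval when `k > 2ⁿ`). -/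
def node (n k : ℕ) : Icc (0 : ℝ) L := projIcc 0 L hL.le (k * L / 2 ^ n)

/-- The hat function of height one centred at `k L / 2ⁿ`. -/
def hat (L : ℝ) (n k : ℕ) (x : ℝ) : ℝ := max 0 (1 - |2 ^ n * x / L - k|)

lemma hat_nonneg (n k : ℕ) (x : ℝ) : 0 ≤ hat L n k x := le_max_left _ _

@[fun_prop]
lemma continuous_hat (n k : ℕ) : Continuous (hat L n k) := by
  unfold hat; fun_prop

lemma sum_hat_pos {L : ℝ} (hL : 0 < L) (n : ℕ) (x : Icc (0 : ℝ) L) :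
    0 < ∑ k ∈ Finset.range (2 ^ n + 1), hat L n k x := by
  have hx0 : 0 ≤ 2 ^ n * (x : ℝ) / L := by have := x.2.1; positivity
  have hx1 : 2 ^ n * (x : ℝ) / L ≤ (2 ^ n : ℕ) := by
    rw [div_le_iff₀ hL]
    push_cast
    exact mul_le_mul_of_nonneg_left x.2.2 (by positivity)
  refine Finset.sum_pos' (fun k _ => hat_nonneg _ _ _) ⟨⌊2 ^ n * (x : ℝ) / L⌋₊, ?_, ?_⟩
  · have := Nat.floor_le_of_le hx1
    exact Finset.mem_range.2 (Nat.lt_succ_of_le this)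
  · refine lt_max_of_lt_right (sub_pos.2 ?_)
    have h1 := Nat.floor_le hx0
    have h2 := Nat.lt_floor_add_one (2 ^ n * (x : ℝ) / L)
    rw [abs_lt]
    constructor <;> linarith

/-- The partition of unity of `[0, L]` subordinate to the dyadic grid of level `n`, obtained by
normalizing the hat functions. -/
def weight (n k : ℕ) : C(Icc (0 : ℝ) L, ℝ) where
  toFun x := hat L n k x / ∑ j ∈ Finset.range (2 ^ n + 1), hat L n j x
  continuous_toFun := by
    refine Continuous.div (by fun_prop) (by fun_prop) fun x => (sum_hat_pos hL n x).ne'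

lemma weight_nonneg (n k : ℕ) (x : Icc (0 : ℝ) L) : 0 ≤ weight hL n k x :=
  div_nonneg (hat_nonneg _ _ _) (sum_hat_pos hL n x).le

lemma sum_weight (n : ℕ) (x : Icc (0 : ℝ) L) :
    ∑ k ∈ Finset.range (2 ^ n + 1), weight hL n k x = 1 := by
  simp only [weight, ContinuousMap.coe_mk]
  rw [← Finset.sum_div, div_self (sum_hat_pos hL n x).ne']

lemma dist_node_le {n k : ℕ} {x : Icc (0 : ℝ) L} (hk : k ∈ Finset.range (2 ^ n + 1))
    (h : weight hL n k x ≠ 0) : dist x (node hL n k) ≤ L / 2 ^ n := by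
  have h1 : hat L n k x ≠ 0 := fun h0 => h (by simp [weight, h0])
  have h2 : 0 < 1 - |2 ^ n * (x : ℝ) / L - k| := by
    by_contra hc
    exact h1 (max_eq_left (not_lt.1 hc))
  have hkn : (k : ℝ) ≤ 2 ^ n := by exact_mod_cast Nat.lt_succ_iff.1 (Finset.mem_range.1 hk)
  have hmem : k * L / 2 ^ n ∈ Icc 0 L := ⟨by positivity, by
    rw [div_le_iff₀ (by positivity), mul_comm L]
    exact mul_le_mul_of_nonneg_right hkn hL.le⟩
  rw [node, projIcc_of_mem _ hmem, Subtype.dist_eq, Real.dist_eq]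
  have : (x : ℝ) - k * L / 2 ^ n = L / 2 ^ n * (2 ^ n * (x : ℝ) / L - k) := by field_simp
  rw [this, abs_mul, abs_of_pos (by positivity : 0 < L / 2 ^ n)]
  exact mul_le_of_le_one_right (by positivity) (by linarith)

/-- The function with value `∑ k, a k * weight k`; for `a k = f (node k)` it interpolates `f`. -/
def interp (n : ℕ) (a : ℕ → ℝ) : C(Icc (0 : ℝ) L, ℝ) :=
  ∑ k ∈ Finset.range (2 ^ n + 1), a k • weight hL n k

lemma interp_apply (n : ℕ) (a : ℕ → ℝ) (x : Icc (0 : ℝ) L) :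
    interp hL n a x = ∑ k ∈ Finset.range (2 ^ n + 1), weight hL n k x • a k := by
  simp [interp, ContinuousMap.sum_apply, mul_comm]

lemma tendsto_div_two_pow (c : ℝ) :
    Filter.Tendsto (fun n : ℕ => c / 2 ^ n) Filter.atTop (nhds 0) := by
  have := (tendsto_pow_atTop_nhds_zero_of_lt_one (r := (1 / 2 : ℝ)) (by norm_num)
    (by norm_num)).const_mul c
  simpa [div_eq_mul_inv] using this

/-- Averages of a uniformly continuous map over the nodes near `x` converge to its value at `x`,
uniformly in `x`. -/
lemma eventually_norm_sum_weight_smul_sub_le {E : Type*} [SeminormedAddCommGroup E]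
    [NormedSpace ℝ E] {f : Icc (0 : ℝ) L → E} (hf : Continuous f) {ε : ℝ} (hε : 0 < ε) :
    ∀ᶠ n in Filter.atTop, ∀ x,
      ‖∑ k ∈ Finset.range (2 ^ n + 1), weight hL n k x • f (node hL n k) - f x‖ ≤ ε := by
  obtain ⟨δ, hδ, h⟩ := Metric.uniformContinuous_iff.1
    (CompactSpace.uniformContinuous_of_continuous hf) ε hε
  filter_upwards [(tendsto_div_two_pow L).eventually (gt_mem_nhds hδ)] with n hn x
  have : ∑ k ∈ Finset.range (2 ^ n + 1), weight hL n k x • f (node hL n k) - f x =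
      ∑ k ∈ Finset.range (2 ^ n + 1), weight hL n k x • (f (node hL n k) - f x) := by
    simp only [smul_sub, Finset.sum_sub_distrib, ← Finset.sum_smul, sum_weight, one_smul]
  rw [this]
  refine norm_sum_smul_le_of_weights (fun k _ => weight_nonneg hL n k x) (sum_weight hL n x)
    fun k hk hw => ?_
  rw [← dist_eq_norm]
  exact (h ((dist_comm _ _).trans_le (dist_node_le hL hk hw) |>.trans_lt hn)).le

lemma tendsto_interp (f : C(Icc (0 : ℝ) L, ℝ)) :
    Filter.Tendsto (fun n => interp hL n fun k => f (node hL n k)) Filter.atTop (nhds f) := by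
  rw [Metric.tendsto_atTop']
  intro ε hε
  obtain ⟨N, hN⟩ := Filter.eventually_atTop.1
    (eventually_norm_sum_weight_smul_sub_le hL f.continuous (half_pos hε))
  refine ⟨N, fun n hn => lt_of_le_of_lt ?_ (half_lt_self hε)⟩
  rw [ContinuousMap.dist_le (half_pos hε).le]
  intro x
  rw [dist_eq_norm, interp_apply]
  exact hN n hn.le x

/-- Two interpolants of consecutive levels differ at most by the largest difference of data at
nearby nodes. -/
lemma norm_interp_sub_interp_le (n : ℕ) (a b : ℕ → ℝ) {ε : ℝ}
    (h : ∀ j ∈ Finset.range (2 ^ (n + 1) + 1), ∀ k ∈ Finset.range (2 ^ n + 1),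
      dist (node hL (n + 1) j) (node hL n k) ≤ 2 * L / 2 ^ n → |a j - b k| ≤ ε) (hε : 0 ≤ ε) :
    ‖interp hL (n + 1) a - interp hL n b‖ ≤ ε := by
  rw [ContinuousMap.norm_le _ hε]
  intro x
  rw [ContinuousMap.sub_apply, interp_apply, interp_apply]
  set B := ∑ k ∈ Finset.range (2 ^ n + 1), weight hL n k x • b k with hB
  have : ∑ j ∈ Finset.range (2 ^ (n + 1) + 1), weight hL (n + 1) j x • a j - B =
      ∑ j ∈ Finset.range (2 ^ (n + 1) + 1), weight hL (n + 1) j x • (a j - B) := by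
    simp only [smul_sub, Finset.sum_sub_distrib, ← Finset.sum_smul, sum_weight, one_smul]
  rw [this]
  refine norm_sum_smul_le_of_weights (fun k _ => weight_nonneg hL _ k x) (sum_weight hL _ x)
    fun j hj hwj => ?_
  have : a j - B = ∑ k ∈ Finset.range (2 ^ n + 1), weight hL n k x • (a j - b k) := by
    simp only [smul_sub, Finset.sum_sub_distrib, ← Finset.sum_smul, sum_weight, one_smul, hB]
  rw [this]
  refine norm_sum_smul_le_of_weights (fun k _ => weight_nonneg hL _ k x) (sum_weight hL _ x)
    fun k hk hwk => ?_
  refine h j hj k hk ?_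
  have h1 := dist_node_le hL hj hwj
  have h2 := dist_node_le hL hk hwk
  have h3 : L / 2 ^ (n + 1) ≤ L / 2 ^ n :=
    div_le_div_of_nonneg_left hL.le (by positivity) (pow_le_pow_right₀ one_le_two n.le_succ)
  calc _ ≤ dist x (node hL (n + 1) j) + dist x (node hL n k) := dist_triangle_left _ _ _
    _ ≤ L / 2 ^ n + L / 2 ^ n := add_le_add (h1.trans h3) h2
    _ = _ := by ring

end Interpolation

/-! ### Convergence of the interpolated Gaussian process -/

section Existence

/-- The absolute `p`-th moment of the standard normal distribution. -/
def gaussianMoment (p : ℕ) : ℝ≥0∞ := ∫⁻ x, ‖x‖ₑ ^ p ∂(gaussianReal 0 1)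

lemma gaussianMoment_ne_top (p : ℕ) : gaussianMoment p ≠ ∞ := by
  rcases p.eq_zero_or_pos with rfl | hp
  · simp [gaussianMoment]
  have h := (memLp_id_gaussianReal' (μ := 0) (v := 1) p (by simp)).2
  rw [eLpNorm_lt_top_iff_lintegral_rpow_enorm_lt_top (by positivity) (by simp)] at h
  simpa [gaussianMoment] using h.ne

variable {Ω : Type*} [MeasurableSpace Ω] {Pr : Measure Ω}

lemma IsCentredGaussian.lintegral_enorm_pow {f : Lp ℝ 2 Pr} (hf : IsCentredGaussian f) (p : ℕ) :
    ∫⁻ ω, ‖f ω‖ₑ ^ p ∂Pr = ‖f‖ₑ ^ p * gaussianMoment p := by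
  have h1 : gaussianReal 0 (‖f‖₊ ^ 2) = (gaussianReal 0 1).map (‖f‖ * ·) := by
    rw [gaussianReal_map_const_mul]
    congr 1
    · simp
    · ext; simp
  have h2 : ∫⁻ ω, ‖f ω‖ₑ ^ p ∂Pr = ∫⁻ x, ‖x‖ₑ ^ p ∂(Pr.map f) :=
    (lintegral_map' (f := fun x : ℝ => ‖x‖ₑ ^ p) (by fun_prop)
      (Lp.aestronglyMeasurable f).aemeasurable).symm
  rw [h2, hf, h1, lintegral_map (by fun_prop) (by fun_prop), gaussianMoment,
    ← lintegral_const_mul _ (by fun_prop)]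
  simp only [enorm_mul, mul_pow, enorm_norm]

variable {H : Type*} [NormedAddCommGroup H] [InnerProductSpace ℝ H]
  {L : ℝ} (hL : 0 < L) (W : H →ₗᵢ[ℝ] Lp ℝ 2 Pr) (h : Icc (0 : ℝ) L → H)

/-- The interpolation at level `n` of the Gaussian process `x ↦ W (h x)`. -/
def approxPath (n : ℕ) (ω : Ω) : C(Icc (0 : ℝ) L, ℝ) :=
  interp hL n fun k => W (h (node hL n k)) ω

lemma aestronglyMeasurable_approxPath (n : ℕ) :
    AEStronglyMeasurable (approxPath hL W h n) Pr := by
  unfold approxPath interp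
  exact Finset.aestronglyMeasurable_fun_sum _ fun k _ =>
    (Lp.aestronglyMeasurable (W (h (node hL n k)))).smul_const _

/-- The coefficient vector in `H` of a functional applied to the interpolated process. -/
def approxVec (n : ℕ) (φ : StrongDual ℝ C(Icc (0 : ℝ) L, ℝ)) : H :=
  ∑ k ∈ Finset.range (2 ^ n + 1), φ (weight hL n k) • h (node hL n k)

lemma dual_approxPath_ae_eq (n : ℕ) (φ : StrongDual ℝ C(Icc (0 : ℝ) L, ℝ)) :
    (fun ω => φ (approxPath hL W h n ω)) =ᵐ[Pr] W (approxVec hL h n φ) := by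
  have h1 : W (approxVec hL h n φ) =
      ∑ k ∈ Finset.range (2 ^ n + 1), φ (weight hL n k) • W (h (node hL n k)) := by
    simp [approxVec]
  have h2 : ∀ᵐ ω ∂Pr, ∀ k ∈ Finset.range (2 ^ n + 1),
      (φ (weight hL n k) • W (h (node hL n k)) : Lp ℝ 2 Pr) ω =
        φ (weight hL n k) * W (h (node hL n k)) ω := by
    rw [Finset.eventually_all]
    intro k _
    filter_upwards [Lp.coeFn_smul (φ (weight hL n k)) (W (h (node hL n k)))] with ω hω
    rw [hω, Pi.smul_apply, smul_eq_mul]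
  rw [h1]
  filter_upwards [h2, Lp.coeFn_finsetSum (Finset.range (2 ^ n + 1))
    fun k => φ (weight hL n k) • W (h (node hL n k))] with ω h3 h4
  rw [h4, Finset.sum_apply, Finset.sum_congr rfl h3, approxPath, interp, map_sum]
  exact Finset.sum_congr rfl fun k _ => by rw [map_smul, smul_eq_mul, mul_comm]

variable {W h} in
/-- Increments of the Gaussian process have moments controlled by the Hölder continuity of `h`. -/
lemma lintegral_increment_le (hW : ∀ v, IsCentredGaussian (W v)) {C α : ℝ} (hC : 0 ≤ C)
    (hα : 0 < α) (hh : ∀ x y, ‖h x - h y‖ ≤ C * dist x y ^ α) (p : ℕ) {x y : Icc (0 : ℝ) L} {r : ℝ}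
    (hr : dist x y ≤ r) :
    ∫⁻ ω, ‖W (h x) ω - W (h y) ω‖ₑ ^ p ∂Pr ≤
      ENNReal.ofReal ((C * r ^ α) ^ p) * gaussianMoment p := by
  have hb : 0 ≤ C * r ^ α := mul_nonneg hC (Real.rpow_nonneg (dist_nonneg.trans hr) α)
  have h1 : ∫⁻ ω, ‖W (h x) ω - W (h y) ω‖ₑ ^ p ∂Pr = ∫⁻ ω, ‖W (h x - h y) ω‖ₑ ^ p ∂Pr := by
    refine lintegral_congr_ae ?_
    rw [map_sub]
    filter_upwards [Lp.coeFn_sub (W (h x)) (W (h y))] with ω hω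
    rw [hω, Pi.sub_apply]
  rw [h1, (hW _).lintegral_enorm_pow, ENNReal.ofReal_pow hb]
  gcongr
  rw [W.enorm_map, ← ofReal_norm]
  refine ENNReal.ofReal_le_ofReal ((hh x y).trans ?_)
  gcongr

/-- The sup norm of the difference of consecutive interpolations is at most the largest increment
over pairs of nearby nodes, which is bounded by the `ℓ^p` norm of these increments. -/
lemma enorm_approxPath_sub_pow_le (n : ℕ) {p : ℕ} (hp : p ≠ 0) (ω : Ω) :
    ‖approxPath hL W h (n + 1) ω - approxPath hL W h n ω‖ₑ ^ p ≤
      ∑ j ∈ Finset.range (2 ^ (n + 1) + 1), ∑ k ∈ Finset.range (2 ^ n + 1),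
        if dist (node hL (n + 1) j) (node hL n k) ≤ 2 * L / 2 ^ n then
          ‖W (h (node hL (n + 1) j)) ω - W (h (node hL n k)) ω‖ₑ ^ p else 0 := by
  set d : ℕ → ℕ → ℝ := fun j k => W (h (node hL (n + 1) j)) ω - W (h (node hL n k)) ω
  set S : ℝ := ∑ j ∈ Finset.range (2 ^ (n + 1) + 1), ∑ k ∈ Finset.range (2 ^ n + 1),
    if dist (node hL (n + 1) j) (node hL n k) ≤ 2 * L / 2 ^ n then |d j k| ^ p else 0 with hS
  have hterm : ∀ j k, 0 ≤ (if dist (node hL (n + 1) j) (node hL n k) ≤ 2 * L / 2 ^ n then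
      |d j k| ^ p else 0) := fun j k => by split_ifs <;> positivity
  have hS0 : 0 ≤ S := Finset.sum_nonneg fun j _ => Finset.sum_nonneg fun k _ => hterm j k
  have hroot : (S ^ (p : ℝ)⁻¹) ^ p = S := Real.rpow_inv_natCast_pow hS0 hp
  have hnorm : ‖approxPath hL W h (n + 1) ω - approxPath hL W h n ω‖ ≤ S ^ (p : ℝ)⁻¹ := by
    refine norm_interp_sub_interp_le hL n _ _ (fun j hj k hk hd => ?_) (by positivity)
    refine le_of_pow_le_pow_left₀ hp (by positivity) ?_
    rw [hroot]
    have h1 := Finset.single_le_sum (f := fun k =>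
      if dist (node hL (n + 1) j) (node hL n k) ≤ 2 * L / 2 ^ n then |d j k| ^ p else 0)
      (fun k _ => hterm j k) hk
    simp only [if_pos hd] at h1
    exact h1.trans (Finset.single_le_sum (f := fun j => ∑ k ∈ Finset.range (2 ^ n + 1),
      if dist (node hL (n + 1) j) (node hL n k) ≤ 2 * L / 2 ^ n then |d j k| ^ p else 0)
      (fun j _ => Finset.sum_nonneg fun k _ => hterm j k) hj)
  calc _ = ENNReal.ofReal (‖approxPath hL W h (n + 1) ω - approxPath hL W h n ω‖ ^ p) := by
        rw [ENNReal.ofReal_pow (norm_nonneg _), ofReal_norm]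
    _ ≤ ENNReal.ofReal S := by
        refine ENNReal.ofReal_le_ofReal ?_
        rw [← hroot]
        gcongr
    _ = _ := by
        rw [hS, ENNReal.ofReal_sum_of_nonneg
          fun j _ => Finset.sum_nonneg fun k _ => hterm j k]
        refine Finset.sum_congr rfl fun j _ => ?_
        rw [ENNReal.ofReal_sum_of_nonneg fun k _ => hterm j k]
        refine Finset.sum_congr rfl fun k _ => ?_
        split_ifs
        · rw [ENNReal.ofReal_pow (abs_nonneg _), ← Real.norm_eq_abs, ofReal_norm]
        · simp

variable {W h} in
/-- Consecutive interpolations are close in `L^p` when `p α ≥ 3`: there are at most `6 * 4ⁿ` pairs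
of nodes, each contributing a moment of order `8⁻ⁿ`. -/
lemma lintegral_approxPath_sub_le (hW : ∀ v, IsCentredGaussian (W v)) {C α : ℝ} (hC : 0 ≤ C)
    (hα : 0 < α) (hh : ∀ x y, ‖h x - h y‖ ≤ C * dist x y ^ α) {p : ℕ} (hp : 3 ≤ p * α) (n : ℕ) :
    ∫⁻ ω, ‖approxPath hL W h (n + 1) ω - approxPath hL W h n ω‖ₑ ^ p ∂Pr ≤
      (6 * ENNReal.ofReal ((C * (2 * L) ^ α) ^ p) * gaussianMoment p) * 2⁻¹ ^ n := by
  have hp0 : p ≠ 0 := by rintro rfl; norm_num at hp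
  -- nodes of consecutive levels near a common point are at most `r` apart
  set r : ℝ := 2 * L / 2 ^ n with hr
  have hmeas : ∀ j k, AEMeasurable (fun ω => if dist (node hL (n + 1) j) (node hL n k) ≤ r then
      ‖W (h (node hL (n + 1) j)) ω - W (h (node hL n k)) ω‖ₑ ^ p else 0) Pr := fun j k => by
    split_ifs
    · exact ((Lp.aestronglyMeasurable _).sub (Lp.aestronglyMeasurable _)).enorm.pow_const p
    · exact aemeasurable_const
  have hmom : ∀ j k, ∫⁻ ω, (if dist (node hL (n + 1) j) (node hL n k) ≤ r then
      ‖W (h (node hL (n + 1) j)) ω - W (h (node hL n k)) ω‖ₑ ^ p else 0) ∂Pr ≤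
      ENNReal.ofReal ((C * r ^ α) ^ p) * gaussianMoment p := fun j k => by
    split_ifs with hd
    · exact lintegral_increment_le hW hC hα hh p hd
    · simp
  -- the number of pairs times `(r ^ α) ^ p` is of order `2⁻ⁿ`
  have hcount : ((2 : ℝ) ^ (n + 1) + 1) * (2 ^ n + 1) * (C * r ^ α) ^ p ≤
      6 * (C * (2 * L) ^ α) ^ p * (2⁻¹) ^ n := by
    have e1 : (C * r ^ α) ^ p = (C * (2 * L) ^ α) ^ p * (((2 : ℝ) ^ n)⁻¹) ^ (p * α) := by
      rw [hr, div_eq_mul_inv, Real.mul_rpow (by positivity) (by positivity), ← mul_assoc, mul_pow,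
        ← Real.rpow_natCast ((((2 : ℝ) ^ n)⁻¹) ^ α), ← Real.rpow_mul (by positivity), mul_comm α]
    have e2 : (((2 : ℝ) ^ n)⁻¹) ^ (p * α) ≤ (((2 : ℝ) ^ n)⁻¹) ^ 3 := by
      rw [← Real.rpow_natCast _ 3]
      exact Real.rpow_le_rpow_of_exponent_ge (by positivity)
        (inv_le_one_of_one_le₀ (one_le_pow₀ one_le_two)) (by exact_mod_cast hp)
    have e3 : ((2 : ℝ) ^ (n + 1) + 1) * (2 ^ n + 1) ≤ 6 * (2 ^ n * 2 ^ n) := by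
      have : (1 : ℝ) ≤ 2 ^ n := one_le_pow₀ one_le_two
      rw [pow_succ]
      nlinarith
    have hK : 0 ≤ (C * (2 * L) ^ α) ^ p := by positivity
    rw [e1, inv_pow]
    calc _ ≤ 6 * (2 ^ n * 2 ^ n) * ((C * (2 * L) ^ α) ^ p * (((2 : ℝ) ^ n)⁻¹) ^ 3) := by gcongr
      _ = _ := by field_simp
  calc _ ≤ ∫⁻ ω, ∑ j ∈ Finset.range (2 ^ (n + 1) + 1), ∑ k ∈ Finset.range (2 ^ n + 1),
        (if dist (node hL (n + 1) j) (node hL n k) ≤ r then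
          ‖W (h (node hL (n + 1) j)) ω - W (h (node hL n k)) ω‖ₑ ^ p else 0) ∂Pr :=
        lintegral_mono fun ω => enorm_approxPath_sub_pow_le hL W h n hp0 ω
    _ ≤ ∑ j ∈ Finset.range (2 ^ (n + 1) + 1), ∑ k ∈ Finset.range (2 ^ n + 1),
        ENNReal.ofReal ((C * r ^ α) ^ p) * gaussianMoment p := by
        rw [lintegral_finsetSum' _ fun j _ => Finset.aemeasurable_fun_sum _ fun k _ => hmeas j k]
        refine Finset.sum_le_sum fun j _ => ?_
        rw [lintegral_finsetSum' _ fun k _ => hmeas j k]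
        exact Finset.sum_le_sum fun k _ => hmom j k
    _ = ENNReal.ofReal (((2 : ℝ) ^ (n + 1) + 1) * (2 ^ n + 1) * (C * r ^ α) ^ p) *
        gaussianMoment p := by
        have hr0 : 0 ≤ r := by positivity
        rw [Finset.sum_const, Finset.sum_const, Finset.card_range, Finset.card_range, smul_smul,
          nsmul_eq_mul, ENNReal.ofReal_mul (by positivity), ← mul_assoc]
        congr 2
        rw [← ENNReal.ofReal_natCast]
        push_cast
        rfl
    _ ≤ ENNReal.ofReal (6 * (C * (2 * L) ^ α) ^ p * (2⁻¹) ^ n) * gaussianMoment p := by gcongr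
    _ = _ := by
        rw [ENNReal.ofReal_mul (by positivity), ENNReal.ofReal_mul (by positivity),
          ENNReal.ofReal_pow (by positivity), ENNReal.ofReal_pow (by positivity : (0 : ℝ) ≤ 2⁻¹),
          ENNReal.ofReal_inv_of_pos two_pos,
          ENNReal.ofReal_ofNat, ENNReal.ofReal_ofNat]
        ring

lemma memLp_approxPath (hW : ∀ v, IsCentredGaussian (W v)) (n p : ℕ) :
    MemLp (approxPath hL W h n) p Pr := by
  have hY : ∀ v, MemLp (W v) p Pr := fun v => by
    refine ⟨Lp.aestronglyMeasurable _, ?_⟩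
    rcases p.eq_zero_or_pos with rfl | hp
    · simp
    rw [eLpNorm_lt_top_iff_lintegral_rpow_enorm_lt_top (by positivity) (by simp)]
    simp only [ENNReal.toReal_natCast, ENNReal.rpow_natCast]
    rw [(hW v).lintegral_enorm_pow]
    exact ENNReal.mul_lt_top (ENNReal.pow_lt_top enorm_lt_top) (gaussianMoment_ne_top p).lt_top
  unfold approxPath interp
  exact memLp_finsetSum _ fun k _ =>
    (ContinuousLinearMap.toSpanSingleton ℝ (weight hL n k)).comp_memLp' (hY (h (node hL n k)))

variable {W h} in
/-- The interpolated processes converge in the Bochner space `L^p(Ω; C[0, L])`. -/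
lemma exists_tendsto_approxPath (hW : ∀ v, IsCentredGaussian (W v)) {C α : ℝ} (hC : 0 ≤ C)
    (hα : 0 < α) (hh : ∀ x y, ‖h x - h y‖ ≤ C * dist x y ^ α) :
    ∃ (p : ℕ) (F : Ω → C(Icc (0 : ℝ) L, ℝ)), 2 ≤ p ∧ MemLp F p Pr ∧
      Filter.Tendsto (fun n => eLpNorm (approxPath hL W h n - F) p Pr) Filter.atTop (nhds 0) := by
  obtain ⟨q, hq⟩ := exists_nat_ge (3 / α)
  obtain ⟨p, hpq, hp2⟩ : ∃ p : ℕ, q ≤ p ∧ 2 ≤ p := ⟨max q 2, le_max_left _ _, le_max_right _ _⟩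
  have hp : 3 ≤ p * α := by
    rw [div_le_iff₀ hα] at hq
    exact hq.trans (mul_le_mul_of_nonneg_right (by exact_mod_cast hpq) hα.le)
  have hp0 : p ≠ 0 := by omega
  have hp0' : (p : ℝ) ≠ 0 := by exact_mod_cast hp0
  have : Fact (1 ≤ (p : ℝ≥0∞)) := ⟨by exact_mod_cast (by omega : 1 ≤ p)⟩
  have hmem := fun n => memLp_approxPath hL W h hW n p
  set A : ℝ≥0∞ := 6 * ENNReal.ofReal ((C * (2 * L) ^ α) ^ p) * gaussianMoment p with hA
  have hAtop : A ≠ ∞ := ENNReal.mul_ne_top (ENNReal.mul_ne_top (by simp) ENNReal.ofReal_ne_top)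
    (gaussianMoment_ne_top p)
  have hcauchy : CauchySeq fun n => (hmem n).toLp _ := by
    refine cauchySeq_of_edist_le_geometric ((2⁻¹ : ℝ≥0∞) ^ (p : ℝ)⁻¹) (A ^ (p : ℝ)⁻¹) ?_
      (ENNReal.rpow_ne_top_of_nonneg (by positivity) hAtop) fun n => ?_
    · exact ENNReal.rpow_lt_one (by simp) (by positivity)
    · rw [edist_comm, Lp.edist_toLp_toLp,
        eLpNorm_eq_lintegral_rpow_enorm_toReal (by simpa using hp0) (by simp)]
      simp only [ENNReal.toReal_natCast, ENNReal.rpow_natCast, one_div, Pi.sub_apply]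
      calc _ ≤ (A * 2⁻¹ ^ n) ^ (p : ℝ)⁻¹ := by
            gcongr
            exact lintegral_approxPath_sub_le hL hW hC hα hh hp n
        _ = _ := by
            rw [ENNReal.mul_rpow_of_nonneg _ _ (by positivity), ← ENNReal.rpow_natCast,
              ← ENNReal.rpow_natCast, ← ENNReal.rpow_mul, ← ENNReal.rpow_mul, mul_comm (n : ℝ)]
  obtain ⟨F, hF⟩ := cauchySeq_tendsto_of_complete hcauchy
  refine ⟨p, F, hp2, Lp.memLp F, ?_⟩
  rw [Lp.tendsto_Lp_iff_tendsto_eLpNorm'] at hF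
  refine hF.congr fun n => eLpNorm_congr_ae ?_
  filter_upwards [(hmem n).coeFn_toLp] with ω hω
  rw [Pi.sub_apply, Pi.sub_apply, hω]

variable {W h} in
/-- Functionals of the limit path are the `L²` limits of the functionals of the interpolations. -/
lemma tendsto_dual_approxPath [IsProbabilityMeasure Pr] {p : ℕ} (hp : 2 ≤ p)
    {F : Ω → C(Icc (0 : ℝ) L, ℝ)} (hF : MemLp F p Pr)
    (hlim : Filter.Tendsto (fun n => eLpNorm (approxPath hL W h n - F) p Pr) Filter.atTop (nhds 0))
    (φ : StrongDual ℝ C(Icc (0 : ℝ) L, ℝ)) :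
    ∃ hφ : MemLp (fun ω => φ (F ω)) 2 Pr,
      Filter.Tendsto (fun n => W (approxVec hL h n φ)) Filter.atTop (nhds (hφ.toLp _)) := by
  have hp' : (2 : ℝ≥0∞) ≤ p := by exact_mod_cast hp
  have hφ : MemLp (fun ω => φ (F ω)) 2 Pr := φ.comp_memLp' (hF.mono_exponent hp')
  refine ⟨hφ, ?_⟩
  rw [Lp.tendsto_Lp_iff_tendsto_eLpNorm']
  have h0 : Filter.Tendsto (fun n => ‖φ‖ₑ * eLpNorm (approxPath hL W h n - F) p Pr)
      Filter.atTop (nhds 0) := by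
    simpa using ENNReal.Tendsto.const_mul hlim (Or.inr enorm_ne_top)
  refine tendsto_of_tendsto_of_tendsto_of_le_of_le tendsto_const_nhds h0 (fun n => zero_le)
    fun n => ?_
  have hm : AEStronglyMeasurable (approxPath hL W h n - F) Pr :=
    (aestronglyMeasurable_approxPath hL W h n).sub hF.1
  calc _ = eLpNorm (fun ω => φ ((approxPath hL W h n - F) ω)) 2 Pr := by
        refine eLpNorm_congr_ae ?_
        filter_upwards [dual_approxPath_ae_eq hL W h n φ, hφ.coeFn_toLp] with ω h1 h2
        rw [Pi.sub_apply, h2, ← h1, Pi.sub_apply, map_sub]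
    _ ≤ ‖φ‖ₑ * eLpNorm (approxPath hL W h n - F) 2 Pr := by
        refine eLpNorm_le_nnreal_smul_eLpNorm_of_ae_le_mul (c := ‖φ‖₊)
          (Filter.Eventually.of_forall fun ω => φ.le_opNNNorm _) 2
    _ ≤ ‖φ‖ₑ * eLpNorm (approxPath hL W h n - F) p Pr := by
        gcongr
        exact eLpNorm_le_eLpNorm_of_exponent_le hp' hm

end Existence

/-! ### Existence and uniqueness of the Gaussian prior -/

section GaussianPrior

variable {L : ℝ}

/-- A covariance function with a Hölder continuous feature map into a Hilbert space, that is
`c x y = ⟪h x, h y⟫`, is the covariance function of a Gaussian measure on `C[0, L]`: the process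
`W (h x)` of the isonormal process `W` has a continuous version, the limit of its
interpolations. -/
theorem exists_isGaussianPrior {H : Type*} [NormedAddCommGroup H] [InnerProductSpace ℝ H]
    [CompleteSpace H] (hL : 0 < L) {h : Icc (0 : ℝ) L → H} {C α : ℝ} (hC : 0 ≤ C) (hα : 0 < α)
    (hh : ∀ x y, ‖h x - h y‖ ≤ C * dist x y ^ α) {c : ℝ → ℝ → ℝ}
    (hc : ∀ x y : Icc (0 : ℝ) L, inner ℝ (h x) (h y) = c x y) (ubar : LogPerm L) :
    ∃ μ₀ : Measure (LogPerm L), IsGaussianPrior ubar c μ₀ := by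
  obtain ⟨ι, W, hW⟩ := exists_isonormal H
  obtain ⟨p, F, hp, hFp, hlim⟩ := exists_tendsto_approxPath hL hW hC hα hh
  have hFm : AEMeasurable F (gaussianProduct ι) := hFp.1.aemeasurable
  have hcont : Continuous h := by
    have : HolderWith ⟨C, hC⟩ ⟨α, hα.le⟩ h := fun x y => by
      rw [edist_dist, edist_dist, dist_eq_norm,
        ENNReal.ofReal_rpow_of_nonneg dist_nonneg (by exact hα.le)]
      refine (ENNReal.ofReal_le_ofReal (hh x y)).trans_eq ?_
      rw [ENNReal.ofReal_mul hC, ENNReal.ofReal_eq_coe_nnreal hC]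
      rfl
    exact this.continuous hα
  -- all functionals of the limit are centred Gaussian
  have hgauss : ∀ φ : StrongDual ℝ (LogPerm L), ∃ v, (gaussianProduct ι).map (fun ω => φ (F ω)) =
      gaussianReal 0 v := fun φ => by
    obtain ⟨hφ, ht⟩ := tendsto_dual_approxPath hL hp hFp hlim φ
    have hmem : IsCentredGaussian (hφ.toLp _) :=
      isClosed_isCentredGaussian.mem_of_tendsto ht (Filter.Eventually.of_forall fun n => hW _)
    exact ⟨_, (Measure.map_congr hφ.coeFn_toLp).symm.trans hmem⟩
  -- the value of the limit at `x` is `W (h x)`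
  have heval : ∀ x : Icc (0 : ℝ) L, (fun ω => F ω x) =ᵐ[gaussianProduct ι] W (h x) := fun x => by
    obtain ⟨hφ, ht⟩ := tendsto_dual_approxPath hL hp hFp hlim (ContinuousMap.evalCLM ℝ x)
    have hv : Filter.Tendsto (fun n => approxVec hL h n (ContinuousMap.evalCLM ℝ x))
        Filter.atTop (nhds (h x)) := by
      rw [Metric.tendsto_atTop']
      intro ε hε
      obtain ⟨N, hN⟩ := Filter.eventually_atTop.1
        (eventually_norm_sum_weight_smul_sub_le hL hcont (half_pos hε))
      refine ⟨N, fun n hn => lt_of_le_of_lt ?_ (half_lt_self hε)⟩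
      rw [dist_eq_norm]
      exact hN n hn.le x
    have heq := tendsto_nhds_unique ht ((W.continuous.tendsto _).comp hv)
    rw [← heq]
    exact hφ.coeFn_toLp.symm
  have hmean0 : ∀ x : Icc (0 : ℝ) L, ∫ ω, F ω x ∂gaussianProduct ι = 0 := fun x => by
    obtain ⟨v, hv⟩ := hgauss (ContinuousMap.evalCLM ℝ x)
    have hm : AEMeasurable (fun ω => F ω x) (gaussianProduct ι) :=
      (ContinuousMap.evalCLM ℝ x : StrongDual ℝ (LogPerm L)).measurable.comp_aemeasurable hFm
    have : ∫ z, z ∂((gaussianProduct ι).map fun ω => F ω x) = ∫ ω, F ω x ∂gaussianProduct ι :=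
      integral_map hm (by fun_prop)
    rw [← this]
    exact (congrArg (fun m => ∫ z, z ∂m) hv).trans integral_id_gaussianReal
  have hmemLp : ∀ x : Icc (0 : ℝ) L, MemLp (fun ω => F ω x) 2 (gaussianProduct ι) := fun x =>
    (memLp_congr_ae (heval x)).2 (Lp.memLp _)
  have hcov0 : ∀ x y : Icc (0 : ℝ) L,
      cov[fun ω => F ω x, fun ω => F ω y; gaussianProduct ι] = c x y := fun x y => by
    rw [covariance_eq_sub (hmemLp x) (hmemLp y), hmean0, zero_mul, sub_zero, ← hc,
      ← W.inner_map_map, L2.inner_def]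
    refine integral_congr_ae ?_
    filter_upwards [heval x, heval y] with ω h1 h2
    rw [Pi.mul_apply, h1, h2]
    simp [mul_comm]
  have hG : IsGaussian ((gaussianProduct ι).map F) := by
    refine isGaussian_of_map_eq_gaussianReal fun φ => ?_
    obtain ⟨v, hv⟩ := hgauss φ
    refine ⟨0, v, ?_⟩
    rw [AEMeasurable.map_map_of_aemeasurable φ.measurable.aemeasurable hFm]
    exact hv
  have hmap : ((gaussianProduct ι).map F).map (fun u => u + ubar) =
      (gaussianProduct ι).map (fun ω => F ω + ubar) :=
    AEMeasurable.map_map_of_aemeasurable (measurable_add_const ubar).aemeasurable hFm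
  have hFm' : AEMeasurable (fun ω => F ω + ubar) (gaussianProduct ι) := hFm.add_const ubar
  have hev : ∀ x : Icc (0 : ℝ) L, Measurable fun u : LogPerm L => u x := fun x =>
    (ContinuousMap.evalCLM ℝ x : StrongDual ℝ (LogPerm L)).measurable
  refine ⟨((gaussianProduct ι).map F).map fun u => u + ubar, inferInstance, fun x => ?_,
    fun x y => ?_⟩
  · rw [hmap, integral_map hFm' (hev x).aestronglyMeasurable]
    simp only [ContinuousMap.add_apply]
    rw [integral_add ((hmemLp x).integrable one_le_two) (integrable_const _), hmean0]
    simp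
  · rw [hmap, covariance_map_fun (hev x).aestronglyMeasurable (hev y).aestronglyMeasurable hFm']
    simp only [ContinuousMap.add_apply]
    rw [covariance_add_const_left ((hmemLp x).integrable one_le_two),
      covariance_add_const_right ((hmemLp y).integrable one_le_two), hcov0]

/-- A Gaussian measure on `C[0, L]` is determined by its mean and covariance functions. -/
theorem IsGaussianPrior.unique (hL : 0 < L) {ubar : LogPerm L} {c : ℝ → ℝ → ℝ}
    {μ ν : Measure (LogPerm L)} (hμ : IsGaussianPrior ubar c μ) (hν : IsGaussianPrior ubar c ν) :
    μ = ν := by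
  have := hμ.gaussian
  have := hν.gaussian
  refine Measure.ext_of_charFunDual (funext fun φ => ?_)
  -- `φ` is the pointwise limit of the functionals `Φ n`, which only involve point evaluations
  let Φ : ℕ → StrongDual ℝ (LogPerm L) := fun n => ∑ k ∈ Finset.range (2 ^ n + 1),
    φ (weight hL n k) • (ContinuousMap.evalCLM ℝ (node hL n k) : StrongDual ℝ (LogPerm L))
  have hΦ : ∀ n (u : LogPerm L), Φ n u =
      ∑ k ∈ Finset.range (2 ^ n + 1), φ (weight hL n k) * u (node hL n k) := fun n u => by
    simp [Φ, ContinuousMap.evalCLM]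
  have hΦ' : ∀ n (u : LogPerm L), Φ n u = φ (interp hL n fun k => u (node hL n k)) := fun n u => by
    rw [hΦ, interp, map_sum]
    exact Finset.sum_congr rfl fun k _ => by rw [map_smul, smul_eq_mul, mul_comm]
  have hlaw : ∀ ρ : Measure (LogPerm L), IsGaussianPrior ubar c ρ → ∀ n, ρ.map (Φ n) =
      gaussianReal (∑ k ∈ Finset.range (2 ^ n + 1), φ (weight hL n k) * ubar (node hL n k))
        (∑ j ∈ Finset.range (2 ^ n + 1), ∑ k ∈ Finset.range (2 ^ n + 1), φ (weight hL n j) *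
          (φ (weight hL n k) * c (node hL n j) (node hL n k))).toNNReal := fun ρ hρ n => by
    have := hρ.gaussian
    have hmem : ∀ x : Icc (0 : ℝ) L, MemLp (fun u : LogPerm L => u x) 2 ρ := fun x =>
      IsGaussian.memLp_dual ρ (ContinuousMap.evalCLM ℝ x : StrongDual ℝ (LogPerm L)) 2 (by simp)
    rw [IsGaussian.map_eq_gaussianReal]
    have hfun : (Φ n : LogPerm L → ℝ) = fun u =>
        ∑ k ∈ Finset.range (2 ^ n + 1), φ (weight hL n k) * u (node hL n k) := funext (hΦ n)
    rw [hfun]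
    congr 2
    · rw [integral_finsetSum _ fun k _ => ((hmem _).integrable one_le_two).const_mul _]
      exact Finset.sum_congr rfl fun k _ => by rw [integral_const_mul, hρ.mean]
    · rw [variance_fun_sum' fun k _ => (hmem _).const_mul _]
      exact Finset.sum_congr rfl fun j _ => Finset.sum_congr rfl fun k _ => by
        rw [covariance_const_mul_left, covariance_const_mul_right, hρ.covariance]
  have hconv : ∀ ρ : Measure (LogPerm L), IsProbabilityMeasure ρ →
      Filter.Tendsto (fun n => charFunDual ρ (Φ n)) Filter.atTop (nhds (charFunDual ρ φ)) :=
      fun ρ _ => by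
    simp only [charFunDual_apply]
    refine tendsto_integral_of_dominated_convergence (fun _ => 1) (fun n => ?_)
      (integrable_const 1) (fun n => Filter.Eventually.of_forall fun u => ?_)
      (Filter.Eventually.of_forall fun u => ?_)
    · exact (by fun_prop : Continuous fun u => Complex.exp ((Φ n u : ℂ) * Complex.I))
        |>.aestronglyMeasurable
    · rw [Complex.norm_exp_ofReal_mul_I]
    · have h1 : Filter.Tendsto (fun n => Φ n u) Filter.atTop (nhds (φ u)) := by
        simp only [hΦ']
        exact (φ.continuous.tendsto u).comp (tendsto_interp hL u)
      exact ((by fun_prop : Continuous fun r : ℝ =>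
        Complex.exp ((r : ℂ) * Complex.I)).tendsto _).comp h1
  refine tendsto_nhds_unique (hconv μ inferInstance) ?_
  refine (hconv ν inferInstance).congr fun n => ?_
  rw [charFunDual_eq_charFun_map_one, charFunDual_eq_charFun_map_one, hlaw μ hμ, hlaw ν hν]

end GaussianPrior

/-! ### The Whittle-Matérn covariance function -/

section Matern

lemma integrableOn_rpow_mul_exp_neg_mul_exp {ν z : ℝ} (hν : 0 < ν) :
    IntegrableOn (fun t => Real.exp (-t) * t ^ (ν - 1) * Real.exp (-z ^ 2 / (4 * t))) (Ioi 0) := by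
  refine (Real.GammaIntegral_convergent hν).mono' ?_ ?_
  · exact (by fun_prop : Measurable fun t : ℝ =>
      Real.exp (-t) * t ^ (ν - 1) * Real.exp (-z ^ 2 / (4 * t))).aestronglyMeasurable
  · filter_upwards [ae_restrict_mem measurableSet_Ioi] with t ht
    have ht' : 0 < t := ht
    rw [Real.norm_of_nonneg (by positivity)]
    refine mul_le_of_le_one_right (by positivity) (Real.exp_le_one_iff.2 ?_)
    rw [neg_div]
    exact neg_nonpos.2 (by positivity)

/-- Substituting `t = (z / 2) e^s` turns the integral representation of `K_ν` into an integral
against the Gamma density. -/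
lemma besselK_eq_integral {ν z : ℝ} (hν : 0 < ν) (hz : 0 < z) :
    2 ^ (1 - ν) * z ^ ν * besselK ν z =
      ∫ t in Ioi (0 : ℝ), Real.exp (-t) * t ^ (ν - 1) * Real.exp (-z ^ 2 / (4 * t)) := by
  set g : ℝ → ℝ := fun t => Real.exp (-t) * t ^ (ν - 1) * Real.exp (-z ^ 2 / (4 * t)) with hg
  set f : ℝ → ℝ := fun s => z / 2 * Real.exp s with hf
  have himage : f '' univ = Ioi 0 := by
    ext t
    simp only [image_univ, mem_range, mem_Ioi]
    constructor
    · rintro ⟨s, rfl⟩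
      positivity
    · intro ht
      refine ⟨Real.log (2 * t / z), ?_⟩
      rw [hf]
      simp only
      rw [Real.exp_log (by positivity)]
      field_simp
  have hder : ∀ s ∈ univ, HasDerivWithinAt f (f s) univ s := fun s _ =>
    ((Real.hasDerivAt_exp s).const_mul (z / 2)).hasDerivWithinAt
  have hinj : InjOn f univ := fun s _ t _ h => by
    have : (z / 2) ≠ 0 := by positivity
    exact Real.exp_injective (mul_left_cancel₀ this h)
  have hval : ∀ s, |f s| • g (f s) =
      (z / 2) ^ ν * (Real.exp (-z * Real.cosh s) * Real.exp (ν * s)) := fun s => by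
    have hfs : 0 < f s := by positivity
    have h1 : f s * f s ^ (ν - 1) = (z / 2) ^ ν * Real.exp (ν * s) := by
      rw [Real.rpow_sub_one hfs.ne', mul_div_cancel₀ _ hfs.ne', hf]
      simp only
      rw [Real.mul_rpow (by positivity) (by positivity), ← Real.exp_mul, mul_comm s]
    have h2 : Real.exp (-f s) * Real.exp (-z ^ 2 / (4 * f s)) = Real.exp (-z * Real.cosh s) := by
      rw [← Real.exp_add, Real.cosh_eq, hf, Real.exp_neg s]
      congr 1
      have := (Real.exp_pos s).ne'
      field_simp
      ring
    rw [abs_of_pos hfs, smul_eq_mul, hg]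
    calc _ = (f s * f s ^ (ν - 1)) * (Real.exp (-f s) * Real.exp (-z ^ 2 / (4 * f s))) := by ring
      _ = _ := by rw [h1, h2]; ring
  set k : ℝ → ℝ := fun s => Real.exp (-z * Real.cosh s) * Real.exp (ν * s) with hk
  have hzν : (0 : ℝ) < (z / 2) ^ ν := by positivity
  have hint : Integrable k := by
    have h1 := (integrableOn_image_iff_integrableOn_abs_deriv_smul MeasurableSet.univ hder hinj
      g).1 (himage ▸ integrableOn_rpow_mul_exp_neg_mul_exp hν)
    simp only [hval, integrableOn_univ] at h1
    exact (integrable_const_mul_iff (isUnit_iff_ne_zero.2 hzν.ne') _).1 h1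
  have hsub : ∫ t in Ioi (0 : ℝ), g t = (z / 2) ^ ν * ∫ s, k s := by
    rw [← himage, integral_image_eq_integral_abs_deriv_smul MeasurableSet.univ hder hinj]
    simp only [hval, setIntegral_univ]
    exact integral_const_mul _ _
  -- folding the line onto the half line turns `exp (ν s)` into `2 cosh (ν s)`
  have hfold : ∫ s, k s = 2 * besselK ν z := by
    have hneg : ∫ s in Iic (0 : ℝ), k s = ∫ s in Ioi (0 : ℝ), k (-s) := by
      rw [integral_comp_neg_Ioi, neg_zero]
    rw [← intervalIntegral.integral_Iic_add_Ioi hint.integrableOn hint.integrableOn, hneg,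
      ← integral_add hint.comp_neg.integrableOn hint.integrableOn, besselK,
      ← integral_const_mul]
    refine setIntegral_congr_fun measurableSet_Ioi fun s _ => ?_
    simp only [hk, Real.cosh_neg]
    rw [Real.cosh_eq (ν * s), mul_neg]
    ring
  rw [hsub, hfold, Real.div_rpow hz.le zero_le_two, Real.rpow_sub two_pos, Real.rpow_one]
  ring

lemma integral_gammaMeasure {ν : ℝ} (hν : 0 < ν) (f : ℝ → ℝ) :
    ∫ t, f t ∂gammaMeasure ν 1 =
      (Real.Gamma ν)⁻¹ * ∫ t in Ioi (0 : ℝ), Real.exp (-t) * t ^ (ν - 1) * f t := by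
  rw [gammaMeasure, integral_withDensity_eq_integral_toReal_smul
    (f := gammaPDF ν 1) (measurable_gammaPDFReal ν 1).ennreal_ofReal
    (Filter.Eventually.of_forall fun _ => ENNReal.ofReal_lt_top), ← integral_const_mul,
    ← integral_indicator measurableSet_Ioi]
  refine integral_congr_ae ?_
  filter_upwards [Measure.ae_ne volume (0 : ℝ)] with t ht
  rw [gammaPDF, ENNReal.toReal_ofReal (gammaPDFReal_nonneg hν one_pos t), gammaPDFReal]
  rcases lt_or_gt_of_ne ht with h | h
  · rw [if_neg (not_le.2 h), indicator_of_notMem (by simpa using h.le)]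
    simp
  · rw [if_pos h.le, indicator_of_mem (by simpa using h)]
    simp
    ring

lemma ae_gammaMeasure_pos (ν : ℝ) : ∀ᵐ t ∂gammaMeasure ν 1, 0 < t := by
  have hm : Measurable (gammaPDF ν 1) := (measurable_gammaPDFReal ν 1).ennreal_ofReal
  rw [gammaMeasure, ae_withDensity_iff hm]
  filter_upwards [Measure.ae_ne volume (0 : ℝ)] with t ht h
  by_contra hc
  exact h (gammaPDF_of_neg (lt_of_le_of_ne (not_lt.1 hc) ht))

/-- The Whittle-Matérn covariance is a mixture of Gaussian covariances over a Gamma distributed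
scale. -/
lemma maternCov_eq_integral {σ₀ ν l : ℝ} (hν : 0 < ν) (hl : 0 < l) (x y : ℝ) :
    maternCov σ₀ ν l x y =
      σ₀ ^ 2 * ∫ t, Real.exp (-((x - y) ^ 2 / (4 * l ^ 2 * t))) ∂gammaMeasure ν 1 := by
  have := isProbabilityMeasure_gammaMeasure hν one_pos
  unfold maternCov
  split_ifs with h
  · simp [h]
  · have hz : 0 < |x - y| / l := div_pos (abs_pos.2 (sub_ne_zero.2 h)) hl
    have hB := besselK_eq_integral hν hz
    rw [integral_gammaMeasure hν]
    have e : ∀ t, Real.exp (-((x - y) ^ 2 / (4 * l ^ 2 * t))) =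
        Real.exp (-(|x - y| / l) ^ 2 / (4 * t)) := fun t => by
      congr 1
      rw [div_pow, sq_abs, neg_div, div_div]
      ring_nf
    simp only [e]
    rw [← hB]
    ring

lemma integral_cos_mul_gaussianReal (b : ℝ) :
    ∫ z, Real.cos (b * z) ∂gaussianReal 0 1 = Real.exp (-(b ^ 2 / 2)) := by
  have h := charFun_gaussianReal (μ := 0) (v := 1) b
  rw [charFun_apply_real] at h
  have h2 := congrArg Complex.re h
  have hint : Integrable (fun z : ℝ => Complex.exp ((b : ℂ) * z * Complex.I))
      (gaussianReal 0 1) := by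
    refine Integrable.of_bound (C := 1) (by fun_prop) (Filter.Eventually.of_forall fun z => ?_)
    rw [← Complex.ofReal_mul, Complex.norm_exp_ofReal_mul_I]
  rw [← Complex.reCLM_apply, ← ContinuousLinearMap.integral_comp_comm _ hint] at h2
  have e1 : ∀ z : ℝ, Complex.reCLM (Complex.exp ((b : ℂ) * z * Complex.I)) = Real.cos (b * z) :=
    fun z => by rw [← Complex.ofReal_mul, Complex.reCLM_apply, Complex.exp_ofReal_mul_I_re]
  simp only [e1] at h2
  rw [h2]
  have e2 : ((b : ℂ) * (0 : ℝ) * Complex.I - (1 : NNReal) * (b : ℂ) ^ 2 / 2) =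
      ((-(b ^ 2 / 2) : ℝ) : ℂ) := by push_cast; ring
  rw [e2, Complex.exp_ofReal_re]

/-- The mixing measure of the spectral representation: a Gamma distributed scale and a standard
normal variable. -/
abbrev maternMixing (ν : ℝ) : Measure (ℝ × ℝ) := (gammaMeasure ν 1).prod (gaussianReal 0 1)

/-- The random frequency of the Whittle-Matérn process. Given the scale `t` it is normal with
variance `1 / (2 l² t)`, so that `E cos ((x - y) θ) = exp (-(x - y)² / (4 l² t))`. -/
def maternFreq (l : ℝ) (q : ℝ × ℝ) : ℝ := (l * √(2 * q.1))⁻¹ * q.2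

/-- The plane wave `σ₀ e^{i x θ}` in the random frequency `θ`. -/
def maternWave (σ₀ l x : ℝ) (q : ℝ × ℝ) : ℂ :=
  σ₀ * Complex.exp (((x * maternFreq l q : ℝ) : ℂ) * Complex.I)

@[fun_prop]
lemma measurable_maternFreq (l : ℝ) : Measurable (maternFreq l) := by
  unfold maternFreq; fun_prop

lemma memLp_maternWave {ν : ℝ} (hν : 0 < ν) (σ₀ l x : ℝ) :
    MemLp (maternWave σ₀ l x) 2 (maternMixing ν) := by
  have := isProbabilityMeasure_gammaMeasure hν one_pos
  refine MemLp.of_bound (C := |σ₀|) ?_ (Filter.Eventually.of_forall fun q => ?_)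
  · exact (by unfold maternWave; fun_prop : Measurable (maternWave σ₀ l x)).aestronglyMeasurable
  · rw [maternWave, norm_mul, Complex.norm_exp_ofReal_mul_I, mul_one, Complex.norm_real]
    rfl

/-- The feature map of the Whittle-Matérn covariance, with values in the complex `L²` space of the
mixing measure regarded as a real Hilbert space. -/
def maternFeature {ν : ℝ} (hν : 0 < ν) (σ₀ l x : ℝ) : Lp ℂ 2 (maternMixing ν) :=
  (memLp_maternWave hν σ₀ l x).toLp _

lemma inner_maternFeature {σ₀ ν l : ℝ} (hν : 0 < ν) (hl : 0 < l) (x y : ℝ) :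
    inner ℝ (maternFeature hν σ₀ l x) (maternFeature hν σ₀ l y) = maternCov σ₀ ν l x y := by
  have := isProbabilityMeasure_gammaMeasure hν one_pos
  have h1 : inner ℝ (maternFeature hν σ₀ l x) (maternFeature hν σ₀ l y) =
      ∫ q, σ₀ ^ 2 * Real.cos ((x - y) * maternFreq l q) ∂maternMixing ν := by
    rw [L2.inner_def]
    refine integral_congr_ae ?_
    filter_upwards [(memLp_maternWave hν σ₀ l x).coeFn_toLp,
      (memLp_maternWave hν σ₀ l y).coeFn_toLp] with q h1 h2
    simp only [maternFeature, h1, h2]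
    rw [Complex.inner, maternWave, maternWave, map_mul, Complex.conj_ofReal, Complex.exp_mul_I,
      Complex.exp_mul_I, ← Complex.ofReal_cos, ← Complex.ofReal_sin, ← Complex.ofReal_cos,
      ← Complex.ofReal_sin, sub_mul, Real.cos_sub]
    simp only [map_add, map_mul, Complex.conj_ofReal, Complex.conj_I, Complex.mul_re,
      Complex.mul_im, Complex.add_re, Complex.add_im, Complex.neg_re, Complex.neg_im,
      Complex.ofReal_re, Complex.ofReal_im, Complex.I_re, Complex.I_im]
    ring
  have hint : Integrable (fun q => Real.cos ((x - y) * maternFreq l q)) (maternMixing ν) :=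
    Integrable.of_bound (C := 1) (by fun_prop : Measurable fun q =>
      Real.cos ((x - y) * maternFreq l q)).aestronglyMeasurable
      (Filter.Eventually.of_forall fun q => Real.abs_cos_le_one _)
  rw [h1, integral_const_mul, integral_prod _ hint, maternCov_eq_integral hν hl]
  congr 1
  refine integral_congr_ae ?_
  filter_upwards [ae_gammaMeasure_pos ν] with t ht
  simp only [maternFreq, ← mul_assoc]
  rw [integral_cos_mul_gaussianReal, mul_pow, inv_pow, mul_pow, Real.sq_sqrt (by positivity)]
  congr 2
  field_simp
  ring

/-- A negative moment of the Gamma distribution. -/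
def gammaNegMoment (ν α : ℝ) : ℝ := ∫ t, t ^ (-α) ∂gammaMeasure ν 1

lemma gammaNegMoment_nonneg (ν α : ℝ) : 0 ≤ gammaNegMoment ν α :=
  integral_nonneg_of_ae (by
    filter_upwards [ae_gammaMeasure_pos ν] with t ht
    positivity)

lemma integrable_rpow_neg_gammaMeasure {ν α : ℝ} (hν : 0 < ν) (hα : α < ν) :
    Integrable (fun t => t ^ (-α)) (gammaMeasure ν 1) := by
  have hm : Measurable (gammaPDF ν 1) := (measurable_gammaPDFReal ν 1).ennreal_ofReal
  rw [gammaMeasure, integrable_withDensity_iff_integrable_smul' hm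
    (Filter.Eventually.of_forall fun _ => ENNReal.ofReal_lt_top)]
  have h := ((Real.GammaIntegral_convergent (sub_pos.2 hα)).integrable_indicator
    measurableSet_Ioi).const_mul (Real.Gamma ν)⁻¹
  refine h.congr ?_
  filter_upwards [Measure.ae_ne volume (0 : ℝ)] with t ht
  rw [gammaPDF, ENNReal.toReal_ofReal (gammaPDFReal_nonneg hν one_pos t), gammaPDFReal]
  rcases lt_or_gt_of_ne ht with h | h
  · rw [if_neg (not_le.2 h), indicator_of_notMem (by simpa using h.le)]
    simp
  · rw [if_pos h.le, indicator_of_mem (by simpa using h), smul_eq_mul,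
      show ν - α - 1 = (ν - 1) + -α by ring, Real.rpow_add h]
    simp
    ring

lemma one_sub_exp_neg_le_rpow {s α : ℝ} (hs : 0 ≤ s) (hα0 : 0 ≤ α) (hα : α ≤ 1) :
    1 - Real.exp (-s) ≤ s ^ α := by
  rcases le_total s 1 with h | h
  · have h1 := Real.add_one_le_exp (-s)
    have h2 := Real.rpow_le_rpow_of_exponent_ge' hs h hα0 hα
    rw [Real.rpow_one] at h2
    linarith
  · have h1 := Real.exp_pos (-s)
    have h2 := Real.one_le_rpow h hα0
    linarith

/-- The Whittle-Matérn feature map is Hölder continuous with every exponent `α < min ν 1`. -/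
lemma norm_maternFeature_sub_le {σ₀ ν l α : ℝ} (hν : 0 < ν) (hl : 0 < l) (hα0 : 0 < α)
    (hα : α < ν) (hα1 : α ≤ 1) (x y : ℝ) :
    ‖maternFeature hν σ₀ l x - maternFeature hν σ₀ l y‖ ≤
      √(2 * σ₀ ^ 2 * ((4 * l ^ 2) ^ (-α) * gammaNegMoment ν α)) * |x - y| ^ α := by
  have := isProbabilityMeasure_gammaMeasure hν one_pos
  have hdiag : ∀ x, ‖maternFeature hν σ₀ l x‖ ^ 2 = σ₀ ^ 2 := fun x => by
    rw [← real_inner_self_eq_norm_sq, inner_maternFeature hν hl, maternCov, if_pos rfl]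
  have hint : Integrable (fun t => Real.exp (-((x - y) ^ 2 / (4 * l ^ 2 * t))))
      (gammaMeasure ν 1) := by
    refine Integrable.of_bound (C := 1) (by fun_prop : Measurable fun t : ℝ =>
      Real.exp (-((x - y) ^ 2 / (4 * l ^ 2 * t)))).aestronglyMeasurable ?_
    filter_upwards [ae_gammaMeasure_pos ν] with t ht
    rw [Real.norm_of_nonneg (by positivity)]
    exact Real.exp_le_one_iff.2 (neg_nonpos.2 (by positivity))
  have hsq : ‖maternFeature hν σ₀ l x - maternFeature hν σ₀ l y‖ ^ 2 =
      2 * σ₀ ^ 2 * ∫ t, (1 - Real.exp (-((x - y) ^ 2 / (4 * l ^ 2 * t)))) ∂gammaMeasure ν 1 := by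
    rw [norm_sub_sq_real, hdiag, hdiag, inner_maternFeature hν hl, maternCov_eq_integral hν hl,
      integral_sub (integrable_const _) hint]
    simp
    ring
  have hle : ∫ t, (1 - Real.exp (-((x - y) ^ 2 / (4 * l ^ 2 * t)))) ∂gammaMeasure ν 1 ≤
      (4 * l ^ 2) ^ (-α) * gammaNegMoment ν α * (|x - y| ^ α) ^ 2 := by
    rw [gammaNegMoment, ← integral_const_mul, ← integral_mul_const]
    refine integral_mono_ae ((integrable_const _).sub hint)
      (((integrable_rpow_neg_gammaMeasure hν hα).const_mul _).mul_const _) ?_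
    filter_upwards [ae_gammaMeasure_pos ν] with t ht
    refine (one_sub_exp_neg_le_rpow (by positivity) hα0.le hα1).trans_eq ?_
    have e : ((x - y) ^ 2) ^ α = (|x - y| ^ α) ^ 2 := by
      rw [← sq_abs, ← Real.rpow_natCast, ← Real.rpow_mul (abs_nonneg _), mul_comm,
        Real.rpow_mul (abs_nonneg _), Real.rpow_natCast]
    rw [Real.div_rpow (by positivity) (by positivity), Real.mul_rpow (by positivity) ht.le,
      Real.rpow_neg (by positivity), Real.rpow_neg ht.le, e]
    field_simp
  have hM := gammaNegMoment_nonneg ν α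
  refine le_of_sq_le_sq ?_ (by positivity)
  rw [mul_pow, Real.sq_sqrt (by positivity), hsq, mul_assoc (2 * σ₀ ^ 2)]
  gcongr

end Matern

/-- The Whittle-Matérn prior exists and is unique. -/
theorem existsUnique_isGaussianPrior_maternCov {L : ℝ} (hL : 0 < L) (ubar : LogPerm L)
    {σ₀ ν l : ℝ} (hν : 0 < ν) (hl : 0 < l) :
    ∃! μ₀ : Measure (LogPerm L), IsGaussianPrior ubar (maternCov σ₀ ν l) μ₀ := by
  -- the Hölder exponent `min ν 1 / 2` is positive, below `ν` and at most `1`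
  have hα : 0 < min ν 1 / 2 := half_pos (lt_min hν one_pos)
  have hαν : min ν 1 / 2 < ν := (half_lt_self (lt_min hν one_pos)).trans_le (min_le_left _ _)
  have hα1 : min ν 1 / 2 ≤ 1 := (half_lt_self (lt_min hν one_pos)).le.trans (min_le_right _ _)
  obtain ⟨μ₀, h⟩ := exists_isGaussianPrior hL
    (h := fun x : Icc (0 : ℝ) L => maternFeature hν σ₀ l x) (Real.sqrt_nonneg _) hα
    (fun x y => norm_maternFeature_sub_le hν hl hα hαν hα1 x y)
    (fun x y => inner_maternFeature hν hl x y) ubar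
  exact ⟨μ₀, h, fun ν' hν' => hν'.unique hL h⟩

/-! ### The density of the noise -/

section NoiseDensity

lemma map_withDensity_comp {α β : Type*} [MeasurableSpace α] [MeasurableSpace β] (μ : Measure α)
    {f : α → β} (hf : Measurable f) {g : β → ℝ≥0∞} (hg : Measurable g) :
    (μ.withDensity (g ∘ f)).map f = (μ.map f).withDensity g := by
  ext s hs
  rw [Measure.map_apply hf hs, withDensity_apply _ (hf hs), withDensity_apply _ hs,
    setLIntegral_map hs hg hf]
  rfl

/-- A finite product of measures with densities has the product density. -/
lemma pi_withDensity_ofReal {ι : Type*} [Fintype ι] {E : ι → Type*} [∀ i, MeasurableSpace (E i)]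
    (μ : ∀ i, Measure (E i)) [∀ i, SigmaFinite (μ i)] {f : ∀ i, E i → ℝ}
    (hint : ∀ i, Integrable (f i) (μ i)) (hf0 : ∀ i x, 0 ≤ f i x) :
    Measure.pi (fun i => (μ i).withDensity fun x => ENNReal.ofReal (f i x)) =
      (Measure.pi μ).withDensity fun x => ENNReal.ofReal (∏ i, f i (x i)) := by
  have hfin : ∀ i, IsFiniteMeasure ((μ i).withDensity fun x => ENNReal.ofReal (f i x)) := fun i =>
    isFiniteMeasure_withDensity_ofReal (hint i).2
  refine Measure.pi_eq fun s hs => ?_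
  have hpi : MeasurableSet (pi univ s) := MeasurableSet.univ_pi hs
  have hint' : ∀ i, Integrable ((s i).indicator (f i)) (μ i) := fun i =>
    (hint i).indicator (hs i)
  have h0 : ∀ i x, 0 ≤ (s i).indicator (f i) x := fun i x =>
    indicator_nonneg (fun x _ => hf0 i x) x
  have hprod : ∀ x : ∀ i, E i, (pi univ s).indicator (fun x => ENNReal.ofReal (∏ i, f i (x i))) x =
      ENNReal.ofReal (∏ i, (s i).indicator (f i) (x i)) := fun x => by
    by_cases hx : x ∈ pi univ s
    · rw [indicator_of_mem hx]
      congr 1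
      exact Finset.prod_congr rfl fun i _ => (indicator_of_mem (hx i (mem_univ i)) _).symm
    · rw [indicator_of_notMem hx]
      obtain ⟨i, hi⟩ : ∃ i, x i ∉ s i := by simpa [mem_pi] using hx
      rw [Finset.prod_eq_zero (Finset.mem_univ i) (indicator_of_notMem hi _), ENNReal.ofReal_zero]
  rw [withDensity_apply _ hpi, ← lintegral_indicator hpi]
  simp only [hprod]
  rw [← ofReal_integral_eq_lintegral_ofReal (Integrable.fintype_prod_dep hint')
    (Filter.Eventually.of_forall fun x => Finset.prod_nonneg fun i _ => h0 i _),
    integral_fintype_prod_eq_prod, ENNReal.ofReal_prod_of_nonneg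
      fun i _ => integral_nonneg (h0 i)]
  refine Finset.prod_congr rfl fun i _ => ?_
  rw [integral_indicator (hs i), withDensity_apply _ (hs i),
    ofReal_integral_eq_lintegral_ofReal (hint i).integrableOn
      (Filter.Eventually.of_forall fun x => hf0 i x)]

variable {ι : Type*} [Fintype ι]

lemma stdGaussian_eq_withDensity :
    stdGaussian (EuclideanSpace ℝ ι) = volume.withDensity fun x =>
      ENNReal.ofReal ((√(2 * Real.pi))⁻¹ ^ Fintype.card ι * Real.exp (-(1 / 2) * ‖x‖ ^ 2)) := by
  have h1 : (gaussianReal 0 1) = volume.withDensity fun x =>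
      ENNReal.ofReal (gaussianPDFReal 0 1 x) := gaussianReal_of_var_ne_zero 0 one_ne_zero
  have h2 : (fun x : ι → ℝ => ENNReal.ofReal (∏ i, gaussianPDFReal 0 1 (x i))) =
      (fun x : EuclideanSpace ℝ ι => ENNReal.ofReal
        ((√(2 * Real.pi))⁻¹ ^ Fintype.card ι * Real.exp (-(1 / 2) * ‖x‖ ^ 2))) ∘
        (WithLp.toLp 2 : (ι → ℝ) → EuclideanSpace ℝ ι) := by
    funext x
    simp only [Function.comp, gaussianPDFReal]
    rw [Finset.prod_mul_distrib, ← Real.exp_sum, EuclideanSpace.real_norm_sq_eq, Finset.prod_const,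
      Finset.mul_sum]
    simp [Finset.card_univ, div_eq_inv_mul]
  rw [← map_pi_eq_stdGaussian, h1, pi_withDensity_ofReal _
    (fun _ => integrable_gaussianPDFReal 0 1) (fun _ => gaussianPDFReal_nonneg 0 1), h2,
    map_withDensity_comp _ (PiLp.volume_preserving_toLp ι).measurable (by fun_prop)]
  congr 1
  exact (PiLp.volume_preserving_toLp ι).map_eq

open scoped MatrixOrder

variable [DecidableEq ι]

/-- A nondegenerate centred Gaussian measure has a density proportional to `exp (-yᵀ Γ⁻¹ y / 2)`. -/
lemma exists_multivariateGaussian_eq_withDensity {Γ : Matrix ι ι ℝ} (hΓ : Γ.PosDef) :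
    ∃ C : ℝ, 0 < C ∧ multivariateGaussian 0 Γ = volume.withDensity fun y =>
      ENNReal.ofReal (C * Real.exp (-(1 / 2) * (y.ofLp ⬝ᵥ (Γ⁻¹ *ᵥ y.ofLp)))) := by
  -- the measure is the image of the standard Gaussian measure under the invertible map `√Γ`
  set S : Matrix ι ι ℝ := CFC.sqrt Γ with hS
  have hSS : S * S = Γ := CFC.sqrt_mul_sqrt_self Γ hΓ.posSemidef.nonneg
  have hSt : Sᵀ = S := by
    have : IsSelfAdjoint S := (CFC.sqrt_nonneg Γ).isSelfAdjoint
    rw [← conjTranspose_eq_transpose_of_trivial]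
    exact this
  have hdet : IsUnit S.det := by
    have h := (Matrix.isUnit_iff_isUnit_det Γ).1 hΓ.isUnit
    rw [← hSS, det_mul] at h
    exact isUnit_of_mul_isUnit_left h
  set A : EuclideanSpace ℝ ι →L[ℝ] EuclideanSpace ℝ ι := toEuclideanCLM (𝕜 := ℝ) S with hA
  set T : EuclideanSpace ℝ ι →L[ℝ] EuclideanSpace ℝ ι := toEuclideanCLM (𝕜 := ℝ) S⁻¹ with hT
  have hTA : T * A = 1 := by rw [hT, hA, ← map_mul, nonsing_inv_mul _ hdet, map_one]
  have hdetA : LinearMap.det (A : EuclideanSpace ℝ ι →ₗ[ℝ] EuclideanSpace ℝ ι) ≠ 0 := by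
    have h : (T : EuclideanSpace ℝ ι →ₗ[ℝ] EuclideanSpace ℝ ι) ∘ₗ
        (A : EuclideanSpace ℝ ι →ₗ[ℝ] EuclideanSpace ℝ ι) = LinearMap.id := by
      ext1 x
      exact congrArg (fun B : EuclideanSpace ℝ ι →L[ℝ] EuclideanSpace ℝ ι => B x) hTA
    intro h0
    have := congrArg LinearMap.det h
    rw [LinearMap.det_comp, h0, mul_zero, LinearMap.det_id] at this
    exact zero_ne_one this
  have hquad : ∀ y : EuclideanSpace ℝ ι, ‖T y‖ ^ 2 = y.ofLp ⬝ᵥ (Γ⁻¹ *ᵥ y.ofLp) := fun y => by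
    have hinv : S⁻¹ * S⁻¹ = Γ⁻¹ := by rw [← Matrix.mul_inv_rev, hSS]
    have h1 : (T y).ofLp = S⁻¹ *ᵥ y.ofLp := rfl
    rw [EuclideanSpace.real_norm_sq_eq, h1, ← hinv, ← Matrix.mulVec_mulVec, dotProduct_mulVec,
      ← mulVec_transpose, transpose_nonsing_inv, hSt]
    simp [dotProduct, pow_two]
  set C₀ : ℝ := (√(2 * Real.pi))⁻¹ ^ Fintype.card ι with hC₀
  have hC₀pos : 0 < C₀ := by positivity
  set g : EuclideanSpace ℝ ι → ℝ≥0∞ := fun y =>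
    ENNReal.ofReal (C₀ * Real.exp (-(1 / 2) * ‖T y‖ ^ 2)) with hg
  have hgm : Measurable g := by fun_prop
  have hcomp : (fun x => ENNReal.ofReal (C₀ * Real.exp (-(1 / 2) * ‖x‖ ^ 2))) = g ∘ A := by
    funext x
    have : T (A x) = x :=
      congrArg (fun B : EuclideanSpace ℝ ι →L[ℝ] EuclideanSpace ℝ ι => B x) hTA
    simp only [Function.comp, hg, this]
  have hD : 0 < |(LinearMap.det (A : EuclideanSpace ℝ ι →ₗ[ℝ] EuclideanSpace ℝ ι))⁻¹| :=
    abs_pos.2 (inv_ne_zero hdetA)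
  refine ⟨|(LinearMap.det (A : EuclideanSpace ℝ ι →ₗ[ℝ] EuclideanSpace ℝ ι))⁻¹| * C₀,
    mul_pos hD hC₀pos, ?_⟩
  have hmap := Measure.map_linearMap_addHaar_eq_smul_addHaar
    (volume : Measure (EuclideanSpace ℝ ι)) hdetA
  have hfun : (fun x : EuclideanSpace ℝ ι => (0 : EuclideanSpace ℝ ι) + A x) = A := by
    funext x; rw [zero_add]
  rw [multivariateGaussian, ← hS, ← hA, hfun, stdGaussian_eq_withDensity, ← hC₀, hcomp,
    map_withDensity_comp _ A.measurable hgm]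
  have hmap' : Measure.map A (volume : Measure (EuclideanSpace ℝ ι)) = ENNReal.ofReal
      |(LinearMap.det (A : EuclideanSpace ℝ ι →ₗ[ℝ] EuclideanSpace ℝ ι))⁻¹| • volume := hmap
  rw [hmap', withDensity_smul_measure, ← withDensity_smul _ hgm]
  congr 1
  funext y
  rw [Pi.smul_apply, smul_eq_mul, hg, ← ENNReal.ofReal_mul (abs_nonneg _), ← hquad, mul_assoc]

lemma posDef_noiseCov {M : ℕ} {γ : ℝ} (hγ : 0 < γ) {Γp : Matrix (Fin M) (Fin M) ℝ}
    (hΓp : Γp.PosDef) : (noiseCov γ Γp).PosDef := by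
  refine PosDef.of_dotProduct_mulVec_pos ?_ fun v hv => ?_
  · refine IsHermitian.fromBlocks ?_ (by simp) hΓp.isHermitian
    ext i j
    simp
  · have h : star v ⬝ᵥ (noiseCov γ Γp *ᵥ v) = γ * v (Sum.inl ()) ^ 2 +
        star (v ∘ Sum.inr) ⬝ᵥ (Γp *ᵥ (v ∘ Sum.inr)) := by
      rw [noiseCov, fromBlocks_mulVec]
      simp [dotProduct, mulVec]
      ring
    rw [h]
    by_cases h0 : v ∘ Sum.inr = 0
    · have h1 : v (Sum.inl ()) ≠ 0 := fun h1 => hv (by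
        funext i
        rcases i with i | i
        · exact h1
        · exact congrFun h0 i)
      rw [h0]
      simp only [star_zero, zero_dotProduct, add_zero]
      positivity
    · have := hΓp.dotProduct_mulVec_pos h0
      positivity

end NoiseDensity

/-! ### Bayes' theorem with additive noise -/

section Bayes

variable {𝓨 𝓧 : Type*} [MeasurableSpace 𝓨] [MeasurableSpace 𝓧]

/-- The posterior kernel, which has density `ℓ y u / ∫ ℓ y` with respect to the prior `μ₀`. It is a
Markov kernel when the evidence `∫ ℓ y` is positive and finite for every `y`; where the evidence
vanishes it is the zero measure. -/
def bayesKernel (μ₀ : Measure 𝓧) [IsProbabilityMeasure μ₀] (ℓ : 𝓨 → 𝓧 → ℝ) : Kernel 𝓨 𝓧 :=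
  (Kernel.const 𝓨 μ₀).withDensity fun y u => ENNReal.ofReal (1 / (∫ v, ℓ y v ∂μ₀) * ℓ y u)

variable {μ₀ : Measure 𝓧} [IsProbabilityMeasure μ₀] {ℓ : 𝓨 → 𝓧 → ℝ}

lemma measurable_bayesDensity (hℓ : Measurable (Function.uncurry ℓ)) :
    Measurable (Function.uncurry fun y u =>
      ENNReal.ofReal (1 / (∫ v, ℓ y v ∂μ₀) * ℓ y u)) := by
  have hZ : Measurable fun y => ∫ v, ℓ y v ∂μ₀ :=
    (hℓ.stronglyMeasurable.integral_prod_right (ν := μ₀)).measurable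
  exact (((hZ.comp measurable_fst).const_div 1).mul hℓ).ennreal_ofReal

lemma bayesKernel_apply (hℓ : Measurable (Function.uncurry ℓ)) (y : 𝓨) :
    bayesKernel μ₀ ℓ y = μ₀.withDensity fun u =>
      ENNReal.ofReal (1 / (∫ v, ℓ y v ∂μ₀) * ℓ y u) := by
  rw [bayesKernel, Kernel.withDensity_apply _ (measurable_bayesDensity hℓ), Kernel.const_apply]

lemma isMarkovKernel_bayesKernel (hℓ : Measurable (Function.uncurry ℓ)) (hpos : ∀ y u, 0 < ℓ y u)
    (hint : ∀ y, Integrable (ℓ y) μ₀) (hZ : ∀ y, 0 < ∫ u, ℓ y u ∂μ₀) :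
    IsMarkovKernel (bayesKernel μ₀ ℓ) := by
  refine ⟨fun y => ⟨?_⟩⟩
  rw [bayesKernel_apply hℓ, withDensity_apply _ MeasurableSet.univ, Measure.restrict_univ,
    ← ofReal_integral_eq_lintegral_ofReal ((hint y).const_mul _)
      (Filter.Eventually.of_forall fun u => by have := hZ y; have := hpos y u; positivity),
    integral_const_mul, one_div_mul_cancel (hZ y).ne', ENNReal.ofReal_one]

lemma bayesKernel_absolutelyContinuous (hℓ : Measurable (Function.uncurry ℓ)) (y : 𝓨) :
    bayesKernel μ₀ ℓ y ≪ μ₀ := by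
  rw [bayesKernel_apply hℓ]
  exact withDensity_absolutelyContinuous _ _

lemma rnDeriv_bayesKernel (hℓ : Measurable (Function.uncurry ℓ)) (y : 𝓨) :
    (bayesKernel μ₀ ℓ y).rnDeriv μ₀ =ᵐ[μ₀] fun u =>
      ENNReal.ofReal (1 / (∫ v, ℓ y v ∂μ₀) * ℓ y u) := by
  rw [bayesKernel_apply hℓ]
  exact Measure.rnDeriv_withDensity _
    ((measurable_bayesDensity hℓ).comp (measurable_const.prodMk measurable_id))

/-- Bayes' theorem for a dominated model: if the pair of datum and parameter has density
proportional to the likelihood with respect to the product of a reference measure and the prior,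
then disintegrating this density gives the posterior. -/
lemma hasCondDistrib_bayesKernel {Ω : Type*} [MeasurableSpace Ω] {Pr : Measure Ω}
    {lam : Measure 𝓨} [SigmaFinite lam] (hℓ : Measurable (Function.uncurry ℓ))
    (hpos : ∀ y u, 0 < ℓ y u) (hint : ∀ y, Integrable (ℓ y) μ₀) (hZ : ∀ y, 0 < ∫ u, ℓ y u ∂μ₀)
    {c : ℝ} (hc : 0 < c) {Y : Ω → 𝓨} {U : Ω → 𝓧}
    (hlaw : HasLaw (fun ω => (Y ω, U ω))
      ((lam.prod μ₀).withDensity fun q => ENNReal.ofReal (c * ℓ q.1 q.2)) Pr) :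
    HasCondDistrib U Y (bayesKernel μ₀ ℓ) Pr := by
  have := isMarkovKernel_bayesKernel hℓ hpos hint hZ
  set Z : 𝓨 → ℝ := fun y => ∫ u, ℓ y u ∂μ₀ with hZdef
  have hZm : Measurable Z := (hℓ.stronglyMeasurable.integral_prod_right (ν := μ₀)).measurable
  set f : 𝓨 → 𝓧 → ℝ≥0∞ := fun y u => ENNReal.ofReal (1 / Z y * ℓ y u) with hf
  have hfm : Measurable (Function.uncurry f) := measurable_bayesDensity hℓ
  have hjm : Measurable fun q : 𝓨 × 𝓧 => ENNReal.ofReal (c * ℓ q.1 q.2) :=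
    (hℓ.const_mul c).ennreal_ofReal
  have hmarg : Measurable fun y => ENNReal.ofReal (c * Z y) := (hZm.const_mul c).ennreal_ofReal
  -- the marginal law of the datum
  have hY : Pr.map Y = lam.withDensity fun y => ENNReal.ofReal (c * Z y) := by
    have h1 : Pr.map Y = (Pr.map fun ω => (Y ω, U ω)).map Prod.fst :=
      (AEMeasurable.map_map_of_aemeasurable measurable_fst.aemeasurable hlaw.aemeasurable).symm
    rw [h1, hlaw.map_eq]
    ext s hs
    rw [Measure.map_apply measurable_fst hs, withDensity_apply _ (measurable_fst hs),
      withDensity_apply _ hs, ← lintegral_indicator (measurable_fst hs), ← lintegral_indicator hs,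
      lintegral_prod _ ((hjm.indicator (measurable_fst hs)).aemeasurable)]
    refine lintegral_congr fun y => ?_
    by_cases hy : y ∈ s
    · rw [indicator_of_mem hy]
      have : ∀ u, (Prod.fst ⁻¹' s).indicator (fun q : 𝓨 × 𝓧 => ENNReal.ofReal (c * ℓ q.1 q.2))
          (y, u) = ENNReal.ofReal (c * ℓ y u) := fun u =>
        indicator_of_mem (show (y, u) ∈ Prod.fst ⁻¹' s from hy) _
      simp only [this]
      rw [← ofReal_integral_eq_lintegral_ofReal ((hint y).const_mul c)
        (Filter.Eventually.of_forall fun u => (mul_pos hc (hpos y u)).le), integral_const_mul]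
    · rw [indicator_of_notMem hy]
      have : ∀ u, (Prod.fst ⁻¹' s).indicator (fun q : 𝓨 × 𝓧 => ENNReal.ofReal (c * ℓ q.1 q.2))
          (y, u) = 0 := fun u =>
        indicator_of_notMem (show (y, u) ∉ Prod.fst ⁻¹' s from hy) _
      simp only [this, lintegral_zero]
  unfold HasCondDistrib
  have : IsSFiniteKernel ((Kernel.const 𝓨 μ₀).withDensity f) :=
    (inferInstance : IsSFiniteKernel (bayesKernel μ₀ ℓ))
  have hcomp : (Pr.map Y) ⊗ₘ (bayesKernel μ₀ ℓ) =
      (lam.prod μ₀).withDensity fun q => ENNReal.ofReal (c * ℓ q.1 q.2) := by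
    have hp : bayesKernel μ₀ ℓ = (Kernel.const 𝓨 μ₀).withDensity f := rfl
    have h1 : Measurable fun q : 𝓨 × 𝓧 => ENNReal.ofReal (c * Z q.1) := hmarg.comp measurable_fst
    have h2 : Measurable fun q : 𝓨 × 𝓧 => f q.1 q.2 := hfm
    rw [hY, hp, Measure.compProd_withDensity hfm, Measure.compProd_const,
      prod_withDensity_left hmarg, ← withDensity_mul _ h1 h2]
    congr 1
    funext q
    have := hZ q.1
    rw [Pi.mul_apply, ← ENNReal.ofReal_mul (by positivity)]
    congr 1
    have : Z q.1 ≠ 0 := this.ne'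
    field_simp
  rw [hcomp]
  exact hlaw

/-- Additive noise: if `ε` has density `R` with respect to a translation invariant measure and is
independent of `U`, then `(g U + ε, U)` has density `R (y - g u)`. -/
lemma hasLaw_add_noise {Ω : Type*} [MeasurableSpace Ω] {Pr : Measure Ω} [IsProbabilityMeasure Pr]
    {E : Type*} [AddCommGroup E] [MeasurableSpace E] [MeasurableAdd₂ E] [MeasurableSub₂ E]
    {lam : Measure E} [SigmaFinite lam] [lam.IsAddLeftInvariant] {R : E → ℝ≥0∞}
    (hR : Measurable R) [IsFiniteMeasure (lam.withDensity R)] {U : Ω → 𝓧} {ε : Ω → E} {g : 𝓧 → E}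
    (hg : Measurable g) (hU : HasLaw U μ₀ Pr) (hε : HasLaw ε (lam.withDensity R) Pr)
    (hind : IndepFun U ε Pr) :
    HasLaw (fun ω => (g (U ω) + ε ω, U ω))
      ((lam.prod μ₀).withDensity fun q => R (q.1 - g q.2)) Pr := by
  have hjoint : HasLaw (fun ω => (U ω, ε ω)) (μ₀.prod (lam.withDensity R)) Pr :=
    hind.hasLaw_prod hU hε
  have hT : MeasurePreserving (fun q : 𝓧 × E => (g q.1 + q.2, q.1)) (μ₀.prod lam)
      (lam.prod μ₀) := by
    have h1 : MeasurePreserving (fun q : 𝓧 × E => (q.1, g q.1 + q.2)) (μ₀.prod lam)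
        (μ₀.prod lam) :=
      (MeasurePreserving.id μ₀).skew_product (g := fun u e => g u + e)
        ((hg.comp measurable_fst).add measurable_snd)
        (Filter.Eventually.of_forall fun u => map_add_left_eq_self lam (g u))
    exact Measure.measurePreserving_swap.comp h1
  have hψ : Measurable fun q : E × 𝓧 => R (q.1 - g q.2) :=
    hR.comp (measurable_fst.sub (hg.comp measurable_snd))
  have hmap : (μ₀.prod (lam.withDensity R)).map (fun q : 𝓧 × E => (g q.1 + q.2, q.1)) =
      (lam.prod μ₀).withDensity fun q => R (q.1 - g q.2) := by
    have hcomp : (fun q : 𝓧 × E => R q.2) =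
        (fun q : E × 𝓧 => R (q.1 - g q.2)) ∘ fun q : 𝓧 × E => (g q.1 + q.2, q.1) := by
      funext q
      simp
    rw [prod_withDensity_right hR, hcomp, map_withDensity_comp _ hT.measurable hψ, hT.map_eq]
  exact HasLaw.comp ⟨hT.measurable.aemeasurable, hmap⟩ hjoint

end Bayes

section Observations

variable {L : ℝ} {M N n : ℕ}

lemma likelihood_pos {a : ℝ} (ha : 0 < a) (Γ : Matrix (Unit ⊕ Fin M) (Unit ⊕ Fin M) ℝ)
    (g y : DataSpace M) : 0 < likelihood a Γ g y := mul_pos ha (Real.exp_pos _)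

lemma likelihood_le {a : ℝ} (ha : 0 < a) {Γ : Matrix (Unit ⊕ Fin M) (Unit ⊕ Fin M) ℝ}
    (hΓ : Γ.PosDef) (g y : DataSpace M) : likelihood a Γ g y ≤ a := by
  refine mul_le_of_le_one_right ha.le (Real.exp_le_one_iff.2 ?_)
  have := hΓ.inv.posSemidef.dotProduct_mulVec_nonneg (y - g).ofLp
  simp only [star_trivial] at this
  linarith

lemma continuous_likelihood (a : ℝ) (Γ : Matrix (Unit ⊕ Fin M) (Unit ⊕ Fin M) ℝ) :
    Continuous fun q : DataSpace M × DataSpace M => likelihood a Γ q.1 q.2 := by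
  unfold likelihood dotProduct mulVec dotProduct
  fun_prop

variable (hn : n ≤ N) {a : Fin N → ℝ} {Γ : Fin N → Matrix (Unit ⊕ Fin M) (Unit ⊕ Fin M) ℝ}
  {G : Fin N → LogPerm L → DataSpace M}

lemma likelihoodProd_pos (ha : ∀ s, 0 < a s) (y : Fin n → DataSpace M) (u : LogPerm L) :
    0 < likelihoodProd hn a Γ G y u :=
  Finset.prod_pos fun _ _ => likelihood_pos (ha _) _ _ _

lemma measurable_likelihood_comp (a : ℝ) (Γ : Matrix (Unit ⊕ Fin M) (Unit ⊕ Fin M) ℝ) (s : Fin n)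
    {g : LogPerm L → DataSpace M} (hg : Measurable g) :
    Measurable fun q : (Fin n → DataSpace M) × LogPerm L => likelihood a Γ (g q.2) (q.1 s) := by
  have h1 : Measurable fun q : (Fin n → DataSpace M) × LogPerm L => (g q.2, q.1 s) :=
    (hg.comp measurable_snd).prodMk ((measurable_pi_apply s).comp measurable_fst)
  have h2 : Measurable ((fun q : DataSpace M × DataSpace M => likelihood a Γ q.1 q.2) ∘
      fun q : (Fin n → DataSpace M) × LogPerm L => (g q.2, q.1 s)) :=
    (continuous_likelihood a Γ).measurable.comp h1
  exact h2

lemma measurable_likelihoodProd (hG : ∀ s, Measurable (G s)) :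
    Measurable (Function.uncurry (likelihoodProd hn a Γ G)) := by
  have h := Finset.measurable_fun_prod Finset.univ fun (s : Fin n) _ =>
    measurable_likelihood_comp (a (Fin.castLE hn s)) (Γ (Fin.castLE hn s)) s
      (hG (Fin.castLE hn s))
  exact h

lemma integrable_likelihoodProd (ha : ∀ s, 0 < a s) (hΓ : ∀ s, (Γ s).PosDef)
    (hG : ∀ s, Measurable (G s)) (μ₀ : Measure (LogPerm L)) [IsFiniteMeasure μ₀]
    (y : Fin n → DataSpace M) : Integrable (likelihoodProd hn a Γ G y) μ₀ := by
  refine Integrable.of_bound (C := ∏ s : Fin n, a (Fin.castLE hn s))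
    ((measurable_likelihoodProd hn hG).comp (measurable_const.prodMk
      measurable_id)).aestronglyMeasurable (Filter.Eventually.of_forall fun u => ?_)
  rw [Real.norm_of_nonneg (likelihoodProd_pos hn ha y u).le]
  exact Finset.prod_le_prod (fun s _ => (likelihood_pos (ha _) _ _ _).le)
    fun s _ => likelihood_le (ha _) (hΓ _) _ _

lemma integral_likelihoodProd_pos (ha : ∀ s, 0 < a s) (hΓ : ∀ s, (Γ s).PosDef)
    (hG : ∀ s, Measurable (G s)) (μ₀ : Measure (LogPerm L)) [IsProbabilityMeasure μ₀]
    (y : Fin n → DataSpace M) : 0 < ∫ u, likelihoodProd hn a Γ G y u ∂μ₀ := by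
  rw [integral_pos_iff_support_of_nonneg (fun u => (likelihoodProd_pos hn ha y u).le)
    (integrable_likelihoodProd hn ha hΓ hG μ₀ y)]
  have : Function.support (likelihoodProd hn a Γ G y) = univ :=
    eq_univ_of_forall fun u => (likelihoodProd_pos hn ha y u).ne'
  rw [this, measure_univ]
  exact one_pos

/-- The joint law of the data and the parameter has density proportional to the product of the
likelihoods with respect to the product of the Lebesgue measure and the prior. -/
lemma exists_hasLaw_observations (ha : ∀ s, 0 < a s) (hΓ : ∀ s, (Γ s).PosDef)
    (hG : ∀ s, Measurable (G s)) {μ₀ : Measure (LogPerm L)} [IsProbabilityMeasure μ₀]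
    {Ω : Type*} [MeasurableSpace Ω] {Pr : Measure Ω} [IsProbabilityMeasure Pr]
    {U : Ω → LogPerm L} {η : Fin N → Ω → DataSpace M} (hU : HasLaw U μ₀ Pr)
    (hη : ∀ s, HasLaw (η s) (multivariateGaussian 0 (Γ s)) Pr) (hηind : iIndepFun η Pr)
    (hUη : IndepFun U (fun ω s => η s ω) Pr) :
    ∃ c : ℝ, 0 < c ∧ HasLaw (fun ω => (observations hn G U η ω, U ω))
      (((volume : Measure (Fin n → DataSpace M)).prod μ₀).withDensity fun q =>
        ENNReal.ofReal (c * likelihoodProd hn a Γ G q.1 q.2)) Pr := by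
  choose C hC hdens using fun s => exists_multivariateGaussian_eq_withDensity (hΓ s)
  set r : Fin N → DataSpace M → ℝ := fun s y =>
    C s * Real.exp (-(1 / 2) * (y.ofLp ⬝ᵥ ((Γ s)⁻¹ *ᵥ y.ofLp))) with hr
  have hr0 : ∀ s y, 0 ≤ r s y := fun s y => (mul_pos (hC s) (Real.exp_pos _)).le
  have hrc : ∀ s, Continuous (r s) := fun s => by
    simp only [hr]
    unfold dotProduct mulVec dotProduct
    fun_prop
  have hrint : ∀ s, Integrable (r s) := fun s => by
    refine ⟨(hrc s).aestronglyMeasurable, ?_⟩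
    rw [hasFiniteIntegral_iff_ofReal (Filter.Eventually.of_forall (hr0 s))]
    have h1 : (multivariateGaussian 0 (Γ s)) univ = 1 := measure_univ
    rw [hdens, withDensity_apply _ MeasurableSet.univ, Measure.restrict_univ] at h1
    rw [h1]
    exact ENNReal.one_lt_top
  set R : (Fin n → DataSpace M) → ℝ := fun e => ∏ s, r (Fin.castLE hn s) (e s) with hRdef
  have hRm : Measurable fun e => ENNReal.ofReal (R e) :=
    (Finset.measurable_prod _ fun s _ => (hrc _).measurable.comp
      (measurable_pi_apply s)).ennreal_ofReal
  -- the law of the noise in the first `n` observations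
  have hpi : Measure.pi (fun s : Fin n => multivariateGaussian 0 (Γ (Fin.castLE hn s))) =
      (volume : Measure (Fin n → DataSpace M)).withDensity fun e => ENNReal.ofReal (R e) := by
    simp only [hdens]
    exact pi_withDensity_ofReal _ (fun s => hrint (Fin.castLE hn s)) fun s => hr0 (Fin.castLE hn s)
  have hε : HasLaw (fun ω (s : Fin n) => η (Fin.castLE hn s) ω)
      ((volume : Measure (Fin n → DataSpace M)).withDensity fun e => ENNReal.ofReal (R e)) Pr := by
    rw [← hpi]
    exact (hηind.precomp (Fin.castLE_injective hn)).hasLaw_pi fun s => hη _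
  have hfin : IsFiniteMeasure
      ((volume : Measure (Fin n → DataSpace M)).withDensity fun e => ENNReal.ofReal (R e)) := by
    rw [← hpi]; infer_instance
  have hind : IndepFun U (fun ω (s : Fin n) => η (Fin.castLE hn s) ω) Pr :=
    hUη.comp measurable_id (by fun_prop : Measurable fun (e : Fin N → DataSpace M) (s : Fin n) =>
      e (Fin.castLE hn s))
  have hg : Measurable fun (u : LogPerm L) (s : Fin n) => G (Fin.castLE hn s) u :=
    measurable_pi_lambda _ fun s => hG _
  refine ⟨∏ s : Fin n, C (Fin.castLE hn s) / a (Fin.castLE hn s),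
    Finset.prod_pos fun s _ => div_pos (hC _) (ha _), ?_⟩
  have hmain := hasLaw_add_noise hRm hg hU hε hind
  have hfun : (fun q : (Fin n → DataSpace M) × LogPerm L => ENNReal.ofReal
      (R (q.1 - fun s => G (Fin.castLE hn s) q.2))) = fun q => ENNReal.ofReal
        ((∏ s : Fin n, C (Fin.castLE hn s) / a (Fin.castLE hn s)) *
          likelihoodProd hn a Γ G q.1 q.2) := by
    funext q
    rw [hRdef, likelihoodProd, ← Finset.prod_mul_distrib]
    refine congrArg _ (Finset.prod_congr rfl fun s _ => ?_)
    have := (ha (Fin.castLE hn s)).ne'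
    simp only [hr, likelihood, Pi.sub_apply]
    field_simp
  rw [hfun] at hmain
  exact hmain

end Observations

theorem theorem2
    (P : RTMParams) {M N : ℕ}
    -- sensor locations and observation times
    (x : Fin M → ℝ) (hx : ∀ m, x m ∈ Icc 0 P.xstar)
    (t : Fin N → ℝ) (ht : ∀ s, 0 < t s) (htmono : StrictMono t)
    -- mean and Whittle-Matern parameters of the prior
    (ubar : LogPerm P.xstar) (σ₀ ν l : ℝ) (hσ : 0 < σ₀) (hν : 0 < ν) (hl : 0 < l)
    -- noise covariances
    (γ : Fin N → ℝ) (hγ : ∀ s, 0 < γ s)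
    (Γp : Fin N → Matrix (Fin M) (Fin M) ℝ) (hΓp : ∀ s, (Γp s).PosDef)
    -- proportionality constants of the likelihoods
    (a : Fin N → ℝ) (ha : ∀ s, 0 < a s) :
    -- the forward maps are well defined
    (∀ s, ∃! G : LogPerm P.xstar → DataSpace M, IsForwardMap P x (t s) G) ∧
    -- the prior on the space of continuous functions is well defined
    (∃! μ₀ : Measure (LogPerm P.xstar), IsGaussianPrior ubar (maternCov σ₀ ν l) μ₀) ∧
    -- Bayes' theorem
    ∀ G : Fin N → LogPerm P.xstar → DataSpace M, (∀ s, IsForwardMap P x (t s) (G s)) →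
    ∀ μ₀ : Measure (LogPerm P.xstar), IsGaussianPrior ubar (maternCov σ₀ ν l) μ₀ →
    ∀ (Ω : Type*) [MeasurableSpace Ω] (Pr : Measure Ω) [IsProbabilityMeasure Pr]
      (U : Ω → LogPerm P.xstar) (η : Fin N → Ω → DataSpace M),
      HasLaw U μ₀ Pr →
      (∀ s, HasLaw (η s) (multivariateGaussian 0 (noiseCov (γ s) (Γp s))) Pr) →
      iIndepFun η Pr → IndepFun U (fun ω s => η s ω) Pr →
    ∀ (n : ℕ) (_ : 1 ≤ n) (hn : n ≤ N),
      -- the conditional distribution of `U` given the data exists, is essentially unique,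
      -- and has the stated density with respect to the prior
      ∃ μn : Kernel (Fin n → DataSpace M) (LogPerm P.xstar),
        IsMarkovKernel μn ∧ HasCondDistrib U (observations hn G U η) μn Pr ∧
        (∀ κ : Kernel (Fin n → DataSpace M) (LogPerm P.xstar), IsMarkovKernel κ →
          HasCondDistrib U (observations hn G U η) κ Pr →
          ∀ᵐ y ∂(Pr.map (observations hn G U η)), κ y = μn y) ∧
        ∀ y : Fin n → DataSpace M,
          Integrable (likelihoodProd hn a (fun s => noiseCov (γ s) (Γp s)) G y) μ₀ ∧
          0 < ∫ u, likelihoodProd hn a (fun s => noiseCov (γ s) (Γp s)) G y u ∂μ₀ ∧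
          μn y ≪ μ₀ ∧
          (μn y).rnDeriv μ₀ =ᵐ[μ₀] fun u => ENNReal.ofReal
            (1 / (∫ v, likelihoodProd hn a (fun s => noiseCov (γ s) (Γp s)) G y v ∂μ₀) *
              likelihoodProd hn a (fun s => noiseCov (γ s) (Γp s)) G y u) := by
  have hΓ : ∀ s, (noiseCov (γ s) (Γp s)).PosDef := fun s => posDef_noiseCov (hγ s) (hΓp s)
  refine ⟨fun s => ⟨P.forwardMap x (t s), P.isForwardMap_forwardMap x (t s),
    fun G hG => P.eq_forwardMap hx (ht s) hG⟩,
    existsUnique_isGaussianPrior_maternCov P.xstar_pos ubar hν hl, ?_⟩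
  intro G hG μ₀ hμ₀ Ω _ Pr _ U η hU hη hηind hUη n _ hn
  have := hμ₀.gaussian
  have hGm : ∀ s, Measurable (G s) := fun s => by
    rw [P.eq_forwardMap hx (ht s) (hG s)]
    exact P.measurable_forwardMap x (t s)
  obtain ⟨c, hc, hlaw⟩ := exists_hasLaw_observations hn ha hΓ hGm hU hη hηind hUη
  have hm := measurable_likelihoodProd (a := a) (Γ := fun s => noiseCov (γ s) (Γp s)) hn hGm
  have hpos := likelihoodProd_pos (Γ := fun s => noiseCov (γ s) (Γp s)) (G := G) hn ha
  have hint := integrable_likelihoodProd hn ha hΓ hGm μ₀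
  have hZ := integral_likelihoodProd_pos hn ha hΓ hGm μ₀
  have hmarkov := isMarkovKernel_bayesKernel hm hpos hint hZ
  have hcond := hasCondDistrib_bayesKernel hm hpos hint hZ hc hlaw
  refine ⟨bayesKernel μ₀ (likelihoodProd hn a (fun s => noiseCov (γ s) (Γp s)) G), hmarkov, hcond,
    fun κ _ hκ => ?_, fun y => ⟨hint y, hZ y,
      bayesKernel_absolutelyContinuous hm y, rnDeriv_bayesKernel hm y⟩⟩
  have : IsFiniteMeasure (Pr.map (observations hn G U η)) := inferInstance
  exact Kernel.ae_eq_of_compProd_eq (hκ.map_eq.symm.trans hcond.map_eq)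

end
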